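/- Let $\mathfrak A$ be a real or complex unital Banach algebra with norm $|\cdot|$, let $I\subset\mathbb R$ be an interval, let $h:I\to\mathfrak A$ be Lebesgue--Bochner integrable, and let $\phi=h\cdot\mathbf 1_I$ be the $\mathfrak A$-valued measure with density $h$ with respect to Lebesgue measure on $I$. For $A\in\mathfrak A$ put $\mathcal R(A,\lambda)=(A-1)(\lambda+(1-\lambda)A)^{-1}$; call $A$ $\log$-able if its spectrum is disjoint from $(-\infty,0]$, and put $\log A=\int_0^1\mathcal R(A,\lambda)\,d\lambda$. Let $$\mu_k(X_1,\dots,X_k)=\frac{\partial^k}{\partial t_1\cdots\partial t_k}\log\bigl(\exp(t_1X_1)\cdots\exp(t_kX_k)\bigr)\Big|_{t_1=\dots=t_k=0},$$ $$\mu_{\mathrm R[k]}(\phi)=\int_{t_1\le\dots\le t_k\in I}\mu_k(h(t_1),\dots,h(t_k))\,dt_1\cdots dt_k,\qquad \mu_{\mathrm R}(\phi)=\sum_{k\ge1}\mu_{\mathrm R[k]}(\phi),$$ $$\exp_{\mathrm R}(\phi)=1+\sum_{k\ge1}\int_{t_1\le\dots\le t_k\in I}h(t_1)\cdots h(t_k)\,dt_1\cdots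 dt_k,$$ $$R^{(\lambda)}_{\mathrm R[k]}(\phi)=\int_{\mathbf t\in I^k}\lambda^{\mathrm{asc}(\mathbf t)}(\lambda-1)^{\mathrm{des}(\mathbf t)}h(t_1)\cdots h(t_k)\,dt_1\cdots dt_k,$$ where $\mathrm{asc}(\mathbf t)$ and $\mathrm{des}(\mathbf t)$ are the numbers of indices $i$ with $t_i<t_{i+1}$, respectively $t_i>t_{i+1}$, and $0^0=1$. Suppose that $\int|\phi|=\int_I|h(t)|\,dt=2$. Then all these integrals exist, and 1. there is a constant $C<\infty$ such that $\sum_{k\ge1}\bigl|R^{(\lambda)}_{\mathrm R[k]}(\phi)\bigr|\le C$ for all $\lambda\in[0,1]$; 2. the Magnus series converges absolutely: $\sum_{k\ge1}|\mu_{\mathrm R[k]}(\phi)|<\infty$; 3. $\exp_{\mathrm R}(\phi)$ is $\log$-able and the Magnus formula holds in its logarithmic form, $\mu_{\mathrm R}(\phi)=\log\exp_{\mathrm R}(\phi)$, and hence also in its exponential form, $\exp_{\mathrm R}(\phi)=\exp\mu_{\mathrm R}(\phi)$. -/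

import Mathlib

open MeasureTheory

namespace Magnus

/-! Banach algebras are unital complete normed rings with a real normed algebra structure. A complex
Banach algebra is one by restriction of scalars; below, scalars enter only through real numbers. -/

section Resolvent

variable {A : Type*} [NormedRing A] [NormedAlgebra ℝ A]

/-- The resolvent expression `(a - 1) / (lam + (1 - lam) a)`. -/
noncomputable def resolventExpr (a : A) (lam : ℝ) : A :=
  (a - 1) * Ring.inverse (lam • (1 : A) + (1 - lam) • a)

/-- `a` is log-able: its spectrum is disjoint from the closed negative real axis. This involves only
the invertibility of `s - a` for real `s ≤ 0`, so it is the same over `ℝ` and over `ℂ`. -/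
def LogAble (a : A) : Prop :=
  Disjoint (spectrum ℝ a) (Set.Iic 0)

/-- The logarithm `log a = ∫_0^1 (a - 1) / (lam + (1 - lam) a) d lam`. -/
noncomputable def log (a : A) : A :=
  ∫ lam in (0 : ℝ)..1, resolventExpr a lam

/-- The Magnus commutator `μ_k(X_1, …, X_k)`: the mixed partial derivative
`∂^k / ∂t_1 ⋯ ∂t_k` of `log (exp (t_1 X_1) ⋯ exp (t_k X_k))` at `t = 0`. -/
noncomputable def magnusCommutator {k : ℕ} (X : Fin k → A) : A :=
  iteratedFDeriv ℝ k
    (fun t : Fin k → ℝ => log (List.ofFn fun i => NormedSpace.exp (t i • X i)).prod)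
    0 (fun i => Pi.single i 1)

end Resolvent

/-- The number of ascents of a finite sequence of reals. -/
noncomputable def asc {k : ℕ} (t : Fin k → ℝ) : ℕ :=
  Nat.card {p : Fin k × Fin k // p.2.val = p.1.val + 1 ∧ t p.1 < t p.2}

/-- The number of descents of a finite sequence of reals. -/
noncomputable def des {k : ℕ} (t : Fin k → ℝ) : ℕ :=
  Nat.card {p : Fin k × Fin k // p.2.val = p.1.val + 1 ∧ t p.2 < t p.1}

/-- The cube `I^k`. -/
def cube (I : Set ℝ) (k : ℕ) : Set (Fin k → ℝ) :=
  {t | ∀ i, t i ∈ I}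

/-- The ordered tuples `t_1 ≤ … ≤ t_k` in `I`. -/
def simplex (I : Set ℝ) (k : ℕ) : Set (Fin k → ℝ) :=
  {t | Monotone t ∧ ∀ i, t i ∈ I}

section Measures

/-! The `A`-valued measure `φ` is represented by an interval `I` and a density `h` on `I`:
`φ = h · (Lebesgue measure on I)`. -/

variable {A : Type*} [NormedRing A] [NormedAlgebra ℝ A]

/-- The ordered product `h(t_1) ⋯ h(t_k)`. -/
def orderedProd (h : ℝ → A) {k : ℕ} (t : Fin k → ℝ) : A :=
  (List.ofFn fun i => h (t i)).prod

/-- The `k`-th term `∫_{t_1 ≤ … ≤ t_k ∈ I} φ(t_1) ⋯ φ(t_k)` of the time-ordered exponential. -/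
noncomputable def rexpTerm (I : Set ℝ) (h : ℝ → A) (k : ℕ) : A :=
  ∫ t in simplex I k, orderedProd h t

/-- The right time-ordered exponential
`exp_R(φ) = 1 + ∑_{k ≥ 1} ∫_{t_1 ≤ … ≤ t_k ∈ I} φ(t_1) ⋯ φ(t_k)`. -/
noncomputable def rexp (I : Set ℝ) (h : ℝ → A) : A :=
  1 + ∑' n : ℕ, rexpTerm I h (n + 1)

/-- The `k`-th Magnus term `μ_{R[k]}(φ) = ∫_{t_1 ≤ … ≤ t_k ∈ I} μ_k(φ(t_1), …, φ(t_k))`. -/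
noncomputable def magnusTerm (I : Set ℝ) (h : ℝ → A) (k : ℕ) : A :=
  ∫ t in simplex I k, magnusCommutator fun i => h (t i)

/-- The right Magnus expansion `μ_R(φ) = ∑_{k ≥ 1} μ_{R[k]}(φ)`. -/
noncomputable def magnusSeries (I : Set ℝ) (h : ℝ → A) : A :=
  ∑' n : ℕ, magnusTerm I h (n + 1)

/-- The `k`-th term of the resolvent series,
`∫_{t ∈ I^k} lam^{asc t} (lam - 1)^{des t} φ(t_1) ⋯ φ(t_k)`. -/
noncomputable def resolventTerm (I : Set ℝ) (h : ℝ → A) (lam : ℝ) (k : ℕ) : A :=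
  ∫ t in cube I k, (lam ^ asc t * (lam - 1) ^ des t) • orderedProd h t

end Measures

end Magnus

/-! Extend `h` by zero to `g` on the line and let `T_λ f (s) = ∫ k_λ(s,t) g(t) f(t) dt`, where `k_λ`
is `λ` for `s < t` and `λ - 1` otherwise. Iterating `T_λ` on the constant `1` and integrating
against `g` produces the terms of the resolvent series. If the powers of `T_λ` are summable in norm,
`F_λ = ∑ T_λ^n 1` solves `F = 1 + T_λ F` and the series sums to `R_λ = ∫ g F_λ`. Changing `λ` to `m`
only adds the constant `λ - m` to the kernel; uniqueness of the solution turns this into `R_λ = R_m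
+ (λ - m) R_m R_λ` (`resSum_change`). Since `1 + R_1` is the time-ordered exponential, `m = 1`
identifies `R_λ` with its resolvent expression. This gives log-ability and, after integration over
`λ`, the logarithm (`hasSum_log`).

The same argument for counting measure on `Fin k` expands the logarithm of a finite product `∏ (1 +
y i)`. Its multilinear part gives the Magnus commutator as a sum over permutations
(`magnusCommutator_eq_sum`), so each Magnus term is the mean over `λ` of a resolvent term
(`magnusTerm_eq`).

What remains is a bound on `T_λ^n`, summable in `n` and uniform in `λ`, at total norm exactly `2`
(`exists_contracting`). Away from `λ = 1/2` an exponential weight in the cumulative norm makes `T_λ`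
a strict contraction (`norm_volterra_le_weight`). At `λ = 1/2` the kernel is `±1/2` and the trivial
bound on `T` is exactly `1`. The kernel of `T²`, however, contains an integral of `g` against signs
that flip at `t`, and near a Lebesgue point with `g ≠ 0` this cancels. Two such points serve every
`s`, so `T²` is a strict contraction, stably for `λ` near `1/2` (`exists_sq_contraction`). -/

namespace Magnus

/-- The kernel with value `lam` on ascents and `lam - 1` elsewhere. -/
noncomputable def kern {α : Type*} [LinearOrder α] (lam : ℝ) (s t : α) : ℝ :=
  if s < t then lam else lam - 1

theorem abs_kern_le {α : Type*} [LinearOrder α] {lam : ℝ} (hl : lam ∈ Set.Icc (0 : ℝ) 1) (s t : α) : |kern lam s t| ≤ 1 := by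
  unfold kern
  split_ifs <;> rw [abs_le] <;> constructor <;> linarith [hl.1, hl.2]

/-- The difference of the two kernels is a constant. This is the source of the resolvent identity.
-/
theorem kern_eq_add {α : Type*} [LinearOrder α] (lam m : ℝ) (s t : α) : kern lam s t = kern m s t + (lam - m) := by
  unfold kern
  split_ifs <;> ring

/-! ### The integral operators and the resolvent identity. -/

section Volterra

variable {α : Type*} [MeasurableSpace α] [LinearOrder α]
  {A : Type*} [NormedRing A] [NormedAlgebra ℝ A]

/-- The integral operator `f ↦ ∫ kern lam s t • (g t * f t)`. -/
noncomputable def volterra (μ : Measure α) (g : α → A) (lam : ℝ) (f : α → A) (s : α) : A :=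
  ∫ t, kern lam s t • (g t * f t) ∂μ

/-- Almost everywhere strongly measurable functions bounded by `B`. -/
structure BddMeas (μ : Measure α) (f : α → A) (B : ℝ) : Prop where
  aesm : AEStronglyMeasurable f μ
  bound : ∀ s, ‖f s‖ ≤ B

/-- The powers of the operators `volterra μ g lam` are bounded by the terms of a convergent series,
uniformly in `lam`. -/
structure Contracting (μ : Measure α) (g : α → A) (b : ℕ → ℝ) : Prop where
  summable : Summable b
  bound : ∀ lam ∈ Set.Icc (0 : ℝ) 1, ∀ f B, BddMeas μ f B →
    ∀ n s, ‖(volterra μ g lam)^[n] f s‖ ≤ b n * B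

set_option linter.unusedSectionVars false

theorem measurable_kern (hm : MeasurableSet {p : α × α | p.1 < p.2}) (lam : ℝ) :
    Measurable fun p : α × α => kern lam p.1 p.2 :=
  Measurable.ite hm measurable_const measurable_const

variable {μ : Measure α} {g : α → A}

theorem BddMeas.integrable_mul (hg : Integrable g μ) {f : α → A} {B : ℝ} (hf : BddMeas μ f B) :
    Integrable (fun t => g t * f t) μ := by
  refine (hg.norm.mul_const B).mono' (hg.aestronglyMeasurable.mul hf.aesm) (.of_forall fun t => ?_)
  exact (norm_mul_le _ _).trans (mul_le_mul_of_nonneg_left (hf.bound t) (norm_nonneg _))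

theorem integrable_kern_smul (hm : MeasurableSet {p : α × α | p.1 < p.2}) {k : α → A}
    (hk : Integrable k μ) (lam : ℝ) (s : α) : Integrable (fun t => kern lam s t • k t) μ := by
  refine Integrable.mono' (hk.norm.const_mul (|lam| + 1)) (AEStronglyMeasurable.smul
    ((measurable_kern hm lam).comp measurable_prodMk_left).aestronglyMeasurable
    hk.aestronglyMeasurable) (.of_forall fun t => ?_)
  rw [norm_smul, Real.norm_eq_abs]
  gcongr
  unfold kern
  split_ifs
  · linarith
  · exact (abs_sub _ _).trans (by simp)

theorem volterra_mul_const (hm : MeasurableSet {p : α × α | p.1 < p.2}) (hg : Integrable g μ)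
    [CompleteSpace A] {f : α → A} {B : ℝ} (hf : BddMeas μ f B) (lam : ℝ) (a : A) (s : α) :
    volterra μ g lam (fun t => f t * a) s = volterra μ g lam f s * a := by
  unfold volterra
  rw [← integral_mul_const_of_integrable (integrable_kern_smul hm (hf.integrable_mul hg) lam s)]
  simp only [smul_mul_assoc, mul_assoc]

theorem volterra_sub (hm : MeasurableSet {p : α × α | p.1 < p.2}) (hg : Integrable g μ)
    {f₁ f₂ : α → A} {B₁ B₂ : ℝ} (hf₁ : BddMeas μ f₁ B₁) (hf₂ : BddMeas μ f₂ B₂) (lam : ℝ) (s : α) :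
    volterra μ g lam (fun t => f₁ t - f₂ t) s = volterra μ g lam f₁ s - volterra μ g lam f₂ s := by
  unfold volterra
  rw [← integral_sub (integrable_kern_smul hm (hf₁.integrable_mul hg) lam s)
    (integrable_kern_smul hm (hf₂.integrable_mul hg) lam s)]
  simp only [mul_sub, smul_sub]

theorem volterra_change (hm : MeasurableSet {p : α × α | p.1 < p.2}) (hg : Integrable g μ)
    {f : α → A} {B : ℝ} (hf : BddMeas μ f B) (lam m : ℝ) (s : α) :
    volterra μ g lam f s = volterra μ g m f s + (lam - m) • ∫ t, g t * f t ∂μ := by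
  unfold volterra
  rw [← integral_smul, ← integral_add (integrable_kern_smul hm (hf.integrable_mul hg) m s)
    (g := fun t => (lam - m) • (g t * f t)) (by exact (hf.integrable_mul hg).smul (lam - m))]
  simp only [kern_eq_add lam m, add_smul]

theorem norm_volterra_le (hg : Integrable g μ) {lam : ℝ} (hl : lam ∈ Set.Icc (0 : ℝ) 1)
    {f : α → A} {B : ℝ} (hf : BddMeas μ f B) (s : α) :
    ‖volterra μ g lam f s‖ ≤ (∫ t, ‖g t‖ ∂μ) * B := by
  rw [← integral_mul_const]
  refine norm_integral_le_of_norm_le (hg.norm.mul_const B) (.of_forall fun t => ?_)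
  rw [norm_smul, Real.norm_eq_abs]
  calc _ ≤ 1 * (‖g t‖ * B) := by
        gcongr
        · exact abs_kern_le hl s t
        · exact (norm_mul_le _ _).trans (mul_le_mul_of_nonneg_left (hf.bound t) (norm_nonneg _))
    _ = _ := one_mul _

theorem BddMeas.volterra [SFinite μ] (hm : MeasurableSet {p : α × α | p.1 < p.2})
    (hg : Integrable g μ) {lam : ℝ} (hl : lam ∈ Set.Icc (0 : ℝ) 1) {f : α → A} {B : ℝ}
    (hf : BddMeas μ f B) : BddMeas μ (volterra μ g lam f) ((∫ t, ‖g t‖ ∂μ) * B) where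
  aesm := by
    have h : AEStronglyMeasurable (fun p : α × α => kern lam p.1 p.2 • (g p.2 * f p.2))
        (μ.prod μ) :=
      (measurable_kern hm lam).aestronglyMeasurable.smul
        ((hg.aestronglyMeasurable.mul hf.aesm).comp_snd)
    exact h.integral_prod_right'
  bound := norm_volterra_le hg hl hf

theorem BddMeas.iterate [SFinite μ] (hm : MeasurableSet {p : α × α | p.1 < p.2})
    (hg : Integrable g μ) {lam : ℝ} (hl : lam ∈ Set.Icc (0 : ℝ) 1) {f : α → A} {B : ℝ}
    (hf : BddMeas μ f B) (n : ℕ) :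
    BddMeas μ ((Magnus.volterra μ g lam)^[n] f) ((∫ t, ‖g t‖ ∂μ) ^ n * B) := by
  induction n with
  | zero => simpa using hf
  | succ n ih =>
    rw [Function.iterate_succ_apply', pow_succ', mul_assoc]
    exact ih.volterra hm hg hl

theorem BddMeas.one : BddMeas μ (fun _ => (1 : A)) ‖(1 : A)‖ :=
  ⟨aestronglyMeasurable_const, fun _ => le_rfl⟩

theorem BddMeas.mul_const {f : α → A} {B : ℝ} (hf : BddMeas μ f B) (a : A) :
    BddMeas μ (fun t => f t * a) (B * ‖a‖) :=
  ⟨hf.aesm.mul aestronglyMeasurable_const, fun s => (norm_mul_le _ _).trans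
    (mul_le_mul_of_nonneg_right (hf.bound s) (norm_nonneg _))⟩

theorem BddMeas.sub {f₁ f₂ : α → A} {B₁ B₂ : ℝ} (hf₁ : BddMeas μ f₁ B₁) (hf₂ : BddMeas μ f₂ B₂) :
    BddMeas μ (fun t => f₁ t - f₂ t) (B₁ + B₂) :=
  ⟨hf₁.aesm.sub hf₂.aesm, fun s => (norm_sub_le _ _).trans
    (add_le_add (hf₁.bound s) (hf₂.bound s))⟩

/-- The `n`-th term of the resolvent series. -/
noncomputable def resTerm (μ : Measure α) (g : α → A) (lam : ℝ) (n : ℕ) : A :=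
  ∫ t, g t * (Magnus.volterra μ g lam)^[n] (fun _ => 1) t ∂μ

/-- The solution of `F = 1 + volterra μ g lam F`. -/
noncomputable def resSol (μ : Measure α) (g : α → A) (lam : ℝ) (s : α) : A :=
  ∑' n, (Magnus.volterra μ g lam)^[n] (fun _ => 1) s

/-- The sum of the resolvent series. -/
noncomputable def resSum (μ : Measure α) (g : α → A) (lam : ℝ) : A :=
  ∫ t, g t * resSol μ g lam t ∂μ

namespace Contracting

variable {b : ℕ → ℝ} [CompleteSpace A]

theorem hasSum_resSol (hc : Contracting μ g b) {lam : ℝ} (hl : lam ∈ Set.Icc (0 : ℝ) 1) (s : α) :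
    HasSum (fun n => (Magnus.volterra μ g lam)^[n] (fun _ => 1) s) (resSol μ g lam s) :=
  (Summable.of_norm_bounded (hc.summable.mul_right ‖(1 : A)‖)
    (fun n => hc.bound lam hl _ _ BddMeas.one n s)).hasSum

theorem bddMeas_resSol [SFinite μ] (hc : Contracting μ g b)
    (hm : MeasurableSet {p : α × α | p.1 < p.2})
    (hg : Integrable g μ) {lam : ℝ} (hl : lam ∈ Set.Icc (0 : ℝ) 1) :
    BddMeas μ (resSol μ g lam) ((∑' n, b n) * ‖(1 : A)‖) where
  aesm := by
    refine aestronglyMeasurable_of_tendsto_ae Filter.atTop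
      (f := fun n s => ∑ i ∈ Finset.range n, (Magnus.volterra μ g lam)^[i] (fun _ => 1) s)
      (fun n => ?_) (.of_forall fun s => (hc.hasSum_resSol hl s).tendsto_sum_nat)
    exact Finset.aestronglyMeasurable_fun_sum _
      fun i _ => (BddMeas.one.iterate hm hg hl i).aesm
  bound s := by
    rw [← tsum_mul_right]
    exact tsum_of_norm_bounded (hc.summable.mul_right ‖(1 : A)‖).hasSum
      (fun n => hc.bound lam hl _ _ BddMeas.one n s)

theorem norm_resTerm_le [SFinite μ] (hc : Contracting μ g b) (hg : Integrable g μ) {lam : ℝ}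
    (hl : lam ∈ Set.Icc (0 : ℝ) 1) (n : ℕ) :
    ‖resTerm μ g lam n‖ ≤ (∫ t, ‖g t‖ ∂μ) * (b n * ‖(1 : A)‖) := by
  rw [← integral_mul_const]
  refine norm_integral_le_of_norm_le (hg.norm.mul_const _) (.of_forall fun t => ?_)
  exact (norm_mul_le _ _).trans (mul_le_mul_of_nonneg_left
    (hc.bound lam hl _ _ BddMeas.one n t) (norm_nonneg _))

/-- The resolvent series converges to `resSum`. -/
theorem hasSum_integral [SFinite μ] (hc : Contracting μ g b)
    (hm : MeasurableSet {p : α × α | p.1 < p.2})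
    (hg : Integrable g μ) {lam : ℝ} (hl : lam ∈ Set.Icc (0 : ℝ) 1) :
    HasSum (fun n => resTerm μ g lam n) (resSum μ g lam) := by
  refine hasSum_integral_of_dominated_convergence (fun n t => ‖g t‖ * (b n * ‖(1 : A)‖))
    (fun n => ((BddMeas.one.iterate hm hg hl n).integrable_mul hg).aestronglyMeasurable)
    (fun n => .of_forall fun t => ?_)
    (.of_forall fun t => (hc.summable.mul_right _).mul_left _) ?_
    (.of_forall fun t => (hc.hasSum_resSol hl t).mul_left _)
  · exact (norm_mul_le _ _).trans (mul_le_mul_of_nonneg_left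
      (hc.bound lam hl _ _ BddMeas.one n t) (norm_nonneg _))
  · simp_rw [tsum_mul_left]
    exact hg.norm.mul_const _

theorem hasSum_volterra [SFinite μ] (hc : Contracting μ g b)
    (hm : MeasurableSet {p : α × α | p.1 < p.2})
    (hg : Integrable g μ) {lam : ℝ} (hl : lam ∈ Set.Icc (0 : ℝ) 1) (s : α) :
    HasSum (fun n => (Magnus.volterra μ g lam)^[n + 1] (fun _ => 1) s)
      (Magnus.volterra μ g lam (resSol μ g lam) s) := by
  simp_rw [Function.iterate_succ_apply']
  refine hasSum_integral_of_dominated_convergence (fun n t => ‖g t‖ * (b n * ‖(1 : A)‖))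
    (fun n => (integrable_kern_smul hm
      ((BddMeas.one.iterate hm hg hl n).integrable_mul hg) lam s).aestronglyMeasurable)
    (fun n => .of_forall fun t => ?_)
    (.of_forall fun t => (hc.summable.mul_right _).mul_left _) ?_
    (.of_forall fun t => ((hc.hasSum_resSol hl t).mul_left _).const_smul _)
  · rw [norm_smul, Real.norm_eq_abs]
    calc _ ≤ 1 * (‖g t‖ * (b n * ‖(1 : A)‖)) := by
          gcongr
          · exact abs_kern_le hl s t
          · exact (norm_mul_le _ _).trans (mul_le_mul_of_nonneg_left
              (hc.bound lam hl _ _ BddMeas.one n t) (norm_nonneg _))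
      _ = _ := one_mul _
  · simp_rw [tsum_mul_left]
    exact hg.norm.mul_const _

theorem resSol_eq [SFinite μ] (hc : Contracting μ g b)
    (hm : MeasurableSet {p : α × α | p.1 < p.2})
    (hg : Integrable g μ) {lam : ℝ} (hl : lam ∈ Set.Icc (0 : ℝ) 1) (s : α) :
    resSol μ g lam s = 1 + Magnus.volterra μ g lam (resSol μ g lam) s := by
  have h := hc.hasSum_resSol hl s
  rw [← h.tsum_eq, h.summable.tsum_eq_zero_add, (hc.hasSum_volterra hm hg hl s).tsum_eq]
  rfl

/-- A bounded fixed point of `volterra μ g lam` vanishes. -/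
theorem eq_zero_of_fixed (hc : Contracting μ g b) {lam : ℝ} (hl : lam ∈ Set.Icc (0 : ℝ) 1)
    {f : α → A} {B : ℝ} (hf : BddMeas μ f B) (hfix : Magnus.volterra μ g lam f = f) (s : α) :
    f s = 0 := by
  have h : ∀ n, ‖f s‖ ≤ b n * B := fun n => by
    have := hc.bound lam hl f B hf n s
    rwa [Function.iterate_fixed hfix] at this
  have h0 : Filter.Tendsto (fun n => b n * B) Filter.atTop (nhds 0) := by
    simpa using hc.summable.tendsto_atTop_zero.mul_const B
  exact norm_le_zero_iff.mp (ge_of_tendsto' h0 h)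

/-- Set `c = 1 + (lam - m) • resSum μ g lam`. Both sides solve `F = c + T_m F`: the left side
because the change of kernel contributes the constant `c - 1`, the right side because `T_m` commutes
with right multiplication. Their difference is a bounded fixed point of `T_m`. -/
theorem resSol_change [SFinite μ] (hc : Contracting μ g b)
    (hm : MeasurableSet {p : α × α | p.1 < p.2}) (hg : Integrable g μ) {lam m : ℝ}
    (hl : lam ∈ Set.Icc (0 : ℝ) 1) (hm' : m ∈ Set.Icc (0 : ℝ) 1) (s : α) :
    resSol μ g lam s = resSol μ g m s * (1 + (lam - m) • resSum μ g lam) := by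
  have hF := hc.bddMeas_resSol hm hg hl
  have hG := (hc.bddMeas_resSol hm hg hm').mul_const (1 + (lam - m) • resSum μ g lam)
  refine sub_eq_zero.mp (hc.eq_zero_of_fixed hm' (hF.sub hG) ?_ s)
  funext s
  rw [volterra_sub hm hg hF hG, volterra_mul_const hm hg (hc.bddMeas_resSol hm hg hm')]
  have h1 := hc.resSol_eq hm hg hl s
  rw [volterra_change hm hg hF lam m] at h1
  have h2 := hc.resSol_eq hm hg hm' s
  rw [h1]
  conv_rhs => rw [h2]
  rw [add_mul, one_mul]
  unfold resSum
  module

theorem resSum_change [SFinite μ] (hc : Contracting μ g b)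
    (hm : MeasurableSet {p : α × α | p.1 < p.2}) (hg : Integrable g μ) {lam m : ℝ}
    (hl : lam ∈ Set.Icc (0 : ℝ) 1) (hm' : m ∈ Set.Icc (0 : ℝ) 1) :
    resSum μ g lam = resSum μ g m + (lam - m) • (resSum μ g m * resSum μ g lam) := by
  conv_lhs => unfold resSum
  simp_rw [hc.resSol_change hm hg hl hm', ← mul_assoc]
  rw [integral_mul_const_of_integrable ((hc.bddMeas_resSol hm hg hm').integrable_mul hg)]
  change resSum μ g m * _ = _
  rw [mul_add, mul_one, mul_smul_comm]

/-- `1 + (lam - 1) • resSum μ g lam` is the inverse of `1 + (1 - lam) • resSum μ g 1`. -/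
theorem inverse_mul [SFinite μ] (hc : Contracting μ g b)
    (hm : MeasurableSet {p : α × α | p.1 < p.2}) (hg : Integrable g μ) {lam : ℝ}
    (hl : lam ∈ Set.Icc (0 : ℝ) 1) :
    (1 + (lam - 1) • resSum μ g lam) * (1 + (1 - lam) • resSum μ g 1) = 1 ∧
    (1 + (1 - lam) • resSum μ g 1) * (1 + (lam - 1) • resSum μ g lam) = 1 := by
  have h1 : (1 : ℝ) ∈ Set.Icc (0 : ℝ) 1 := by simp
  have ha := hc.resSum_change hm hg hl h1
  have hb := hc.resSum_change hm hg h1 hl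
  set r := resSum μ g lam
  set e := resSum μ g 1
  constructor
  · have : (1 + (lam - 1) • r) * (1 + (1 - lam) • e)
        = 1 + (1 - lam) • (e - (r + (1 - lam) • (r * e))) := by
      simp only [add_mul, mul_add, mul_one, one_mul, smul_mul_assoc, mul_smul_comm]
      module
    rw [this, ← hb]
    simp
  · have : (1 + (1 - lam) • e) * (1 + (lam - 1) • r)
        = 1 + (1 - lam) • (e + (lam - 1) • (e * r) - r) := by
      simp only [add_mul, mul_add, mul_one, one_mul, smul_mul_assoc, mul_smul_comm]
      module
    rw [this, ← ha]
    simp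

/-- The denominator is `1 + (1 - lam) R_1`, whose inverse is `1 + (lam - 1) R_lam`. Multiplying that
inverse by `R_1` gives `R_lam` by the resolvent identity with `m = 1`. -/
theorem resolventExpr_eq [SFinite μ] (hc : Contracting μ g b)
    (hm : MeasurableSet {p : α × α | p.1 < p.2}) (hg : Integrable g μ) {lam : ℝ}
    (hl : lam ∈ Set.Icc (0 : ℝ) 1) : resolventExpr (1 + resSum μ g 1) lam = resSum μ g lam := by
  obtain ⟨h1, h2⟩ := hc.inverse_mul hm hg hl
  have h3 : lam • (1 : A) + (1 - lam) • (1 + resSum μ g 1) = 1 + (1 - lam) • resSum μ g 1 := by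
    module
  let u : Aˣ := ⟨1 + (1 - lam) • resSum μ g 1, 1 + (lam - 1) • resSum μ g lam, h2, h1⟩
  have h4 : Ring.inverse (1 + (1 - lam) • resSum μ g 1) = 1 + (lam - 1) • resSum μ g lam :=
    Ring.inverse_unit u
  rw [resolventExpr, h3, h4, add_sub_cancel_left, mul_add, mul_one, mul_smul_comm]
  exact (hc.resSum_change hm hg hl (by simp)).symm

theorem logAble [SFinite μ] (hc : Contracting μ g b)
    (hm : MeasurableSet {p : α × α | p.1 < p.2}) (hg : Integrable g μ) :
    LogAble (1 + resSum μ g 1) := by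
  rw [LogAble, Set.disjoint_left]
  intro s hs hs0
  refine hs ?_
  rw [Set.mem_Iic] at hs0
  have h1s : 0 < 1 - s := by linarith
  -- This parameter satisfies `1 - lam = 1 / (1 - s)`, so `s - (1 + R_1)` is `-(1 - s)` times the
  -- invertible element `1 + (1 - lam) R_1`.
  have hl : (-s / (1 - s)) ∈ Set.Icc (0 : ℝ) 1 :=
    ⟨div_nonneg (by linarith) h1s.le, by rw [div_le_one h1s]; linarith⟩
  obtain ⟨h1, h2⟩ := hc.inverse_mul hm hg hl
  have hu : IsUnit (1 + (1 - -s / (1 - s)) • resSum μ g 1) := ⟨⟨_, _, h2, h1⟩, rfl⟩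
  have h3 : algebraMap ℝ A s - (1 + resSum μ g 1)
      = (-(1 - s)) • (1 + (1 - -s / (1 - s)) • resSum μ g 1) := by
    rw [Algebra.algebraMap_eq_smul_one, smul_add, smul_smul]
    have : -(1 - s) * (1 - -s / (1 - s)) = -1 := by field_simp; ring
    rw [this]
    module
  rw [spectrum.mem_resolventSet_iff, h3]
  exact hu.smul (Units.mk0 (-(1 - s)) (by linarith))

/-- Termwise integration in `lam`. -/
theorem hasSum_log [SFinite μ] (hc : Contracting μ g b)
    (hm : MeasurableSet {p : α × α | p.1 < p.2}) (hg : Integrable g μ)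
    (hcont : ∀ n, ContinuousOn (fun lam => resTerm μ g lam n) (Set.Icc 0 1)) :
    HasSum (fun n => ∫ lam in (0 : ℝ)..1, resTerm μ g lam n) (log (1 + resSum μ g 1)) := by
  have hI : ∀ lam ∈ Set.uIoc (0 : ℝ) 1, lam ∈ Set.Icc (0 : ℝ) 1 := fun lam hl => by
    rw [Set.uIoc_of_le zero_le_one] at hl
    exact ⟨hl.1.le, hl.2⟩
  refine intervalIntegral.hasSum_integral_of_dominated_convergence
    (fun n _ => (∫ t, ‖g t‖ ∂μ) * (b n * ‖(1 : A)‖))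
    (fun n => ((hcont n).mono hI).aestronglyMeasurable measurableSet_uIoc)
    (fun n => .of_forall fun lam hl => hc.norm_resTerm_le hg (hI lam hl) n)
    (.of_forall fun lam _ => (hc.summable.mul_right _).mul_left _)
    intervalIntegrable_const (.of_forall fun lam hl => ?_)
  rw [hc.resolventExpr_eq hm hg (hI lam hl)]
  exact hc.hasSum_integral hm hg (hI lam hl)

end Contracting

end Volterra

/-! ### The exponential of the logarithm. -/

section ExpLog

variable {A : Type*} [NormedRing A] [NormedAlgebra ℝ A]

theorem commute_ringInverse_right {R : Type*} [Ring R] {a b : R} (h : Commute a b) :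
    Commute a (Ring.inverse b) := by
  by_cases hb : IsUnit b
  · obtain ⟨u, rfl⟩ := hb
    rw [Ring.inverse_unit]
    exact h.units_inv_right
  · rw [Ring.inverse_non_unit _ hb]
    exact Commute.zero_right a

theorem LogAble.isUnit {a : A} (ha : LogAble a) {s : ℝ} (hs : s ∈ Set.Icc (0 : ℝ) 1) :
    IsUnit (1 + s • (a - 1)) := by
  rcases hs.1.eq_or_lt with rfl | h0
  · simp
  have h1 : 1 - s⁻¹ ≤ 0 := sub_nonpos.mpr ((one_le_inv₀ h0).mpr hs.2)
  have h2 : IsUnit (algebraMap ℝ A (1 - s⁻¹) - a) := by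
    by_contra h
    exact Set.disjoint_left.mp ha h h1
  have h3 : 1 + s • (a - 1) = (-s) • (algebraMap ℝ A (1 - s⁻¹) - a) := by
    rw [Algebra.algebraMap_eq_smul_one, smul_sub (-s), smul_smul]
    have : -s * (1 - s⁻¹) = 1 - s := by field_simp; ring
    rw [this]
    module
  rw [h3]
  exact h2.smul (Units.mk0 (-s) (by linarith))

/-- With `x = a - 1`, the primitive `L s` of `x (1 + s x)⁻¹` plays the role of `log (1 + s x)`. All
values of `L` commute, so `exp (-L s) (1 + s x)` has derivative zero on `[0, 1]`. It is `1` at `s =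
0` and `exp (-log a) a` at `s = 1`. -/
theorem LogAble.exp_log [CompleteSpace A] {a : A} (ha : LogAble a) :
    NormedSpace.exp (log a) = a := by
  let _ : NormedAlgebra ℚ A := NormedAlgebra.restrictScalars ℚ ℝ A
  set x := a - 1 with hx
  let V : ℝ → A := fun s => 1 + s • x
  let N : ℝ → A := fun s => x * Ring.inverse (V s)
  let L : ℝ → A := fun s => ∫ u in (0 : ℝ)..s, N u
  let U : Set ℝ := {s | IsUnit (V s)}
  have hV : Continuous V := by fun_prop
  have hU : IsOpen U := Units.isOpen.preimage hV
  have hIU : Set.Icc 0 1 ⊆ U := fun s hs => ha.isUnit hs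
  have hN : ContinuousOn N U := by
    rintro s ⟨u, hu⟩
    have h1 : ContinuousAt Ring.inverse (V s) := hu ▸ NormedRing.inverse_continuousAt u
    exact (continuousAt_const.mul (ContinuousAt.comp (f := V) h1 hV.continuousAt)).continuousWithinAt
  have hlog : log a = L 1 := by
    have h1 : ∀ lam, resolventExpr a lam = N (1 - lam) := fun lam => by
      have : lam • (1 : A) + (1 - lam) • a = 1 + (1 - lam) • (a - 1) := by module
      simp only [resolventExpr, N, V, hx, this]
    simp only [log, h1, L]
    rw [intervalIntegral.integral_comp_sub_left (fun u => N u)]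
    simp
  have hcV : ∀ s t, Commute (V s) (V t) := fun s t =>
    ((Commute.one_right _).add_right (((Commute.one_left x).add_left
      ((Commute.refl x).smul_left s)).smul_right t))
  have hcx : ∀ s, Commute x (V s) := fun s =>
    (Commute.one_right _).add_right ((Commute.refl x).smul_right s)
  have hcN : ∀ s t, Commute (N s) (N t) := fun s t => by
    have h1 : Commute x (N t) := (Commute.refl x).mul_right (commute_ringInverse_right (hcx t))
    have h2 : Commute (V s) (N t) := (hcx s).symm.mul_right (commute_ringInverse_right (hcV s t))
    exact h1.mul_left (commute_ringInverse_right h2.symm).symm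
  have hint : ∀ s ∈ Set.Icc (0 : ℝ) 1, ∀ t ∈ Set.Icc (0 : ℝ) 1,
      IntervalIntegrable N volume s t := fun s hs t ht =>
    (hN.mono ((Set.uIcc_subset_Icc hs ht).trans hIU)).intervalIntegrable
  have hcL : ∀ b : A, (∀ s, Commute b (N s)) → ∀ s ∈ Set.Icc (0 : ℝ) 1, Commute b (L s) := by
    intro b hb s hs
    have hi := hint 0 (by simp) s hs
    simp only [Commute, SemiconjBy, L, intervalIntegral.integral_of_le hs.1]
    rw [← integral_const_mul_of_integrable hi.1, ← integral_mul_const_of_integrable hi.1]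
    exact integral_congr_ae (.of_forall fun t => (hb t).eq)
  have hcLL : ∀ s ∈ Set.Icc (0 : ℝ) 1, ∀ t ∈ Set.Icc (0 : ℝ) 1, Commute (L s) (L t) :=
    fun s hs t ht => hcL _ (fun u => (hcL _ (fun v => hcN u v) s hs).symm) t ht
  have hL : ∀ s ∈ Set.Icc (0 : ℝ) 1, HasDerivAt L (N s) s := fun s hs =>
    intervalIntegral.integral_hasDerivAt_right (hint 0 (by simp) s hs)
      (hN.stronglyMeasurableAtFilter hU s (hIU hs)) (hN.continuousAt (hU.mem_nhds (hIU hs)))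
  have hexp : ∀ s ∈ Set.Icc (0 : ℝ) 1, HasDerivWithinAt (fun y => NormedSpace.exp (-L y))
      (NormedSpace.exp (-L s) * -N s) (Set.Icc 0 1) s := fun s hs => by
    -- By commutation `exp (-L y) = exp (-L s) exp (-(L y - L s))`, so only the derivative of `exp`
    -- at `0` is needed.
    have h1 : HasDerivAt (fun y => -(L y - L s)) (-N s) s := ((hL s hs).sub_const _).neg
    have h2 : HasDerivAt (fun y => NormedSpace.exp (-(L y - L s))) (-N s) s := by
      have h3 : HasFDerivAt (NormedSpace.exp : A → A) (1 : A →L[ℝ] A) (-(L s - L s)) := by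
        simpa using hasFDerivAt_exp_zero (𝕂 := ℝ) (𝔸 := A)
      exact HasFDerivAt.comp_hasDerivAt s h3 h1
    refine (h2.const_mul _).hasDerivWithinAt.congr (fun y hy => ?_) (by simp)
    rw [← NormedSpace.exp_add_of_commute]
    · congr 1; abel
    · exact (((hcLL s hs y hy).sub_right (Commute.refl _)).neg_right).neg_left
  have hD : ∀ s ∈ Set.Icc (0 : ℝ) 1, HasDerivWithinAt (fun y => NormedSpace.exp (-L y) * V y) 0
      (Set.Icc 0 1) s := fun s hs => by
    have h1 : HasDerivAt V x s := by
      have h2 := ((hasDerivAt_id s).smul_const x).const_add 1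
      rwa [one_smul] at h2
    change HasDerivWithinAt ((fun y => NormedSpace.exp (-L y)) * V) 0 _ _
    convert (hexp s hs).mul h1.hasDerivWithinAt using 1
    have h2 : N s * V s = x := by
      simp only [N, mul_assoc, Ring.inverse_mul_cancel _ (hIU hs), mul_one]
    rw [mul_assoc, neg_mul, h2, mul_neg, neg_add_cancel]
  have hconst := constant_of_has_deriv_right_zero (f := fun y => NormedSpace.exp (-L y) * V y)
    (fun s hs => (hD s hs).continuousWithinAt)
    (fun s hs => ((hD s ⟨hs.1, hs.2.le⟩).mono_of_mem_nhdsWithin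
      (Icc_mem_nhdsGE_of_mem hs))) 1 (by simp)
  have h0 : NormedSpace.exp (-L 1) * a = 1 := by
    simpa [V, L, hx] using hconst
  have h1 : NormedSpace.exp (L 1) * NormedSpace.exp (-L 1) = 1 := by
    rw [← NormedSpace.exp_add_of_commute (Commute.refl (L 1)).neg_right]
    simp
  rw [hlog, ← mul_one (NormedSpace.exp (L 1)), ← h0, ← mul_assoc, h1, one_mul]

end ExpLog

/-! ### Iterated integrals over chains. -/

/-- The product of the kernel along a chain. -/
noncomputable def chainWt {α : Type*} [LinearOrder α] (lam : ℝ) {n : ℕ} (t : Fin (n + 1) → α) : ℝ :=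
  ∏ i : Fin n, kern lam (t i.castSucc) (t i.succ)

theorem chainWt_cons {α : Type*} [LinearOrder α] (lam : ℝ) {n : ℕ} (s : α) (t : Fin (n + 1) → α) :
    chainWt lam (Fin.cons s t : Fin (n + 2) → α) = kern lam s (t 0) * chainWt lam t := by
  unfold chainWt
  rw [Fin.prod_univ_succ]
  rfl

theorem continuous_chainWt {α : Type*} [LinearOrder α] {n : ℕ} (t : Fin (n + 1) → α) :
    Continuous fun lam => chainWt lam t := by
  unfold chainWt kern
  refine continuous_finsetProd _ fun i _ => ?_
  split_ifs <;> fun_prop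

theorem abs_chainWt_le {α : Type*} [LinearOrder α] {lam : ℝ} (hl : lam ∈ Set.Icc (0 : ℝ) 1)
    {n : ℕ} (t : Fin (n + 1) → α) : |chainWt lam t| ≤ 1 := by
  unfold chainWt
  rw [Finset.abs_prod]
  exact Finset.prod_le_one (fun _ _ => abs_nonneg _) fun i _ => abs_kern_le hl _ _

/-- The ordered product `g (t 0) ⋯ g (t (n - 1))`. -/
def seqProd {α A : Type*} [Monoid A] (g : α → A) {n : ℕ} (t : Fin n → α) : A :=
  (List.ofFn fun i => g (t i)).prod

theorem seqProd_cons {α A : Type*} [Monoid A] (g : α → A) {n : ℕ} (s : α) (t : Fin n → α) :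
    seqProd g (Fin.cons s t : Fin (n + 1) → α) = g s * seqProd g t := by
  simp [seqProd, List.ofFn_succ]

section Iterated

variable {α : Type*} [MeasurableSpace α] {A : Type*} [NormedRing A]
  {μ : Measure α} [SigmaFinite μ] {g : α → A}

theorem measurePreserving_cons (n : ℕ) :
    MeasurePreserving ((MeasurableEquiv.piFinSuccAbove (fun _ : Fin (n + 1) => α) 0).symm)
      (μ.prod (Measure.pi fun _ : Fin n => μ)) (Measure.pi fun _ : Fin (n + 1) => μ) :=
  (measurePreserving_piFinSuccAbove (fun _ : Fin (n + 1) => μ) 0).symm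

theorem piFinSuccAbove_zero_symm_apply {n : ℕ} (p : α × (Fin n → α)) :
    (MeasurableEquiv.piFinSuccAbove (fun _ : Fin (n + 1) => α) 0).symm p = Fin.cons p.1 p.2 := by
  simp [MeasurableEquiv.piFinSuccAbove]
  rfl

theorem integrable_seqProd (hg : Integrable g μ) (n : ℕ) :
    Integrable (fun t : Fin n → α => seqProd g t) (Measure.pi fun _ => μ) := by
  induction n with
  | zero =>
    simp only [seqProd, List.ofFn_zero, List.prod_nil]
    rw [Measure.pi_of_empty (fun _ : Fin 0 => μ)]
    exact integrable_const _
  | succ n ih =>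
    rw [← (measurePreserving_cons (μ := μ) n).integrable_comp_emb (MeasurableEquiv.measurableEmbedding _)]
    have : (fun t : Fin (n + 1) → α => seqProd g t) ∘
        (MeasurableEquiv.piFinSuccAbove (fun _ : Fin (n + 1) => α) 0).symm =
        fun p : α × (Fin n → α) => g p.1 * seqProd g p.2 := by
      funext p
      rw [Function.comp_apply, piFinSuccAbove_zero_symm_apply, seqProd_cons]
    rw [this]
    refine Integrable.mono' (hg.norm.mul_prod ih.norm)
      (hg.aestronglyMeasurable.comp_fst.mul ih.aestronglyMeasurable.comp_snd)
      (.of_forall fun p => norm_mul_le _ _)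

variable [LinearOrder α] [NormedAlgebra ℝ A]

theorem measurable_chainWt (hm : MeasurableSet {p : α × α | p.1 < p.2}) (lam : ℝ) (n : ℕ) :
    Measurable fun t : Fin (n + 1) → α => chainWt lam t :=
  Finset.measurable_fun_prod _ fun i _ => (measurable_kern hm lam).comp
    (f := fun t : Fin (n + 1) → α => (t i.castSucc, t i.succ))
    ((measurable_pi_apply i.castSucc).prodMk (measurable_pi_apply i.succ))

theorem integrable_chainWt_smul (hm : MeasurableSet {p : α × α | p.1 < p.2})
    (hg : Integrable g μ) {lam : ℝ} (hl : lam ∈ Set.Icc (0 : ℝ) 1) (n : ℕ) {w : α → ℝ}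
    (hw : Measurable w) (hw1 : ∀ s, |w s| ≤ 1) :
    Integrable (fun t : Fin (n + 1) → α => (w (t 0) * chainWt lam t) • seqProd g t)
      (Measure.pi fun _ => μ) := by
  refine (integrable_seqProd hg (n + 1)).norm.mono' (((hw.comp (measurable_pi_apply 0)).mul
    (measurable_chainWt hm lam n)).aestronglyMeasurable.smul
    (integrable_seqProd hg _).aestronglyMeasurable) (.of_forall fun t => ?_)
  rw [norm_smul, Real.norm_eq_abs, abs_mul]
  exact mul_le_of_le_one_left (norm_nonneg _)
    (mul_le_one₀ (hw1 _) (abs_nonneg _) (abs_chainWt_le hl t))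

/-- Fubini in the first variable. The free weight `w` lets one statement serve twice: `w = kern lam
s` drives the induction for the iterates, and `w = 1` gives the resolvent terms. -/
theorem integral_chainWt_smul [CompleteSpace A] (hm : MeasurableSet {p : α × α | p.1 < p.2})
    (hg : Integrable g μ) {lam : ℝ} (hl : lam ∈ Set.Icc (0 : ℝ) 1) (n : ℕ) {w : α → ℝ}
    (hw : Measurable w) (hw1 : ∀ s, |w s| ≤ 1) :
    ∫ t : Fin (n + 1) → α, (w (t 0) * chainWt lam t) • seqProd g t ∂(Measure.pi fun _ => μ) =
    ∫ s, w s • (g s * ∫ t : Fin n → α,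
      chainWt lam (Fin.cons s t : Fin (n + 1) → α) • seqProd g t ∂(Measure.pi fun _ => μ)) ∂μ := by
  have h0 := integrable_chainWt_smul hm hg hl n hw hw1
  rw [← (measurePreserving_cons (μ := μ) n).integrable_comp_emb
    (MeasurableEquiv.measurableEmbedding _)] at h0
  rw [← (measurePreserving_cons (μ := μ) n).integral_comp (MeasurableEquiv.measurableEmbedding _)]
  refine (integral_prod _ h0).trans ?_
  refine integral_congr_ae (.of_forall fun s => ?_)
  have hi : Integrable (fun t : Fin n → α =>
      chainWt lam (Fin.cons s t : Fin (n + 1) → α) • seqProd g t) (Measure.pi fun _ => μ) := by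
    refine (integrable_seqProd hg n).norm.mono' (((measurable_chainWt hm lam n).comp
      (measurable_pi_iff.mpr fun i => ?_)).aestronglyMeasurable.smul
      (integrable_seqProd hg _).aestronglyMeasurable) (.of_forall fun t => ?_)
    · refine Fin.cases ?_ (fun j => ?_) i
      · simp
      · simpa using measurable_pi_apply j
    · rw [norm_smul, Real.norm_eq_abs]
      exact mul_le_of_le_one_left (norm_nonneg _) (abs_chainWt_le hl _)
  simp only [Function.comp_apply, piFinSuccAbove_zero_symm_apply, seqProd_cons, Fin.cons_zero]
  rw [← integral_const_mul_of_integrable hi, ← integral_smul]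
  refine integral_congr_ae (.of_forall fun t => ?_)
  simp only [mul_smul, mul_smul_comm]

theorem volterra_iterate_one [CompleteSpace A] (hm : MeasurableSet {p : α × α | p.1 < p.2})
    (hg : Integrable g μ) {lam : ℝ} (hl : lam ∈ Set.Icc (0 : ℝ) 1) (n : ℕ) (s : α) :
    (volterra μ g lam)^[n] (fun _ => 1) s =
    ∫ t : Fin n → α, chainWt lam (Fin.cons s t : Fin (n + 1) → α) • seqProd g t
      ∂(Measure.pi fun _ => μ) := by
  induction n generalizing s with
  | zero => simp [chainWt, seqProd, Measure.pi_of_empty (fun _ : Fin 0 => μ)]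
  | succ n ih =>
    simp only [chainWt_cons]
    rw [Function.iterate_succ_apply', integral_chainWt_smul hm hg hl n
      (w := kern lam s) ((measurable_kern hm lam).comp measurable_prodMk_left) (abs_kern_le hl s)]
    simp only [volterra, ← ih]

theorem resTerm_eq [CompleteSpace A] (hm : MeasurableSet {p : α × α | p.1 < p.2})
    (hg : Integrable g μ) {lam : ℝ} (hl : lam ∈ Set.Icc (0 : ℝ) 1) (n : ℕ) :
    resTerm μ g lam n =
    ∫ t : Fin (n + 1) → α, chainWt lam t • seqProd g t ∂(Measure.pi fun _ => μ) := by
  have h := integral_chainWt_smul hm hg hl n (w := fun _ => 1) measurable_const (by simp)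
  simp only [one_mul, one_smul, ← volterra_iterate_one hm hg hl] at h
  exact h.symm

end Iterated

/-! ### Cubes, simplices and sorting permutations. -/

theorem ae_injective (k : ℕ) : ∀ᵐ t : Fin k → ℝ, Function.Injective t := by
  have h : ∀ i j : Fin k, i ≠ j → ∀ᵐ t : Fin k → ℝ, t i ≠ t j := fun i j hij => by
    let p : Submodule ℝ (Fin k → ℝ) :=
      LinearMap.ker (LinearMap.proj (R := ℝ) (φ := fun _ => ℝ) i - LinearMap.proj j)
    have hp : p ≠ ⊤ := fun h => by
      have h1 : Pi.single i (1 : ℝ) ∈ p := h ▸ Submodule.mem_top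
      simp [p, hij] at h1
    have h2 := Measure.addHaar_submodule volume p hp
    rw [ae_iff]
    convert h2 using 2
    ext t
    simp [p, sub_eq_zero]
  have h' : ∀ᵐ t : Fin k → ℝ, ∀ i j : Fin k, i ≠ j → t i ≠ t j :=
    ae_all_iff.mpr fun i => ae_all_iff.mpr fun j => by
      by_cases hij : i = j
      · simp [hij]
      · filter_upwards [h i j hij] with t ht _ using ht
  filter_upwards [h'] with t ht i j hij
  by_contra hne
  exact ht i j hne hij

theorem card_consecutive {n : ℕ} (P : Fin (n + 1) → Fin (n + 1) → Prop) [∀ i j, Decidable (P i j)] :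
    Nat.card {p : Fin (n + 1) × Fin (n + 1) // p.2.val = p.1.val + 1 ∧ P p.1 p.2} =
    (Finset.univ.filter fun i : Fin n => P i.castSucc i.succ).card := by
  rw [← Fintype.card_subtype, ← Nat.card_eq_fintype_card]
  refine (Nat.card_congr (Equiv.ofBijective (fun i => ⟨(i.1.castSucc, i.1.succ), by simp, i.2⟩)
    ⟨fun i j hij => ?_, ?_⟩)).symm
  · simp only [Subtype.mk.injEq, Prod.mk.injEq] at hij
    exact Subtype.ext (Fin.castSucc_injective _ hij.1)
  · rintro ⟨⟨a, b⟩, h1, h2⟩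
    simp only at h1 h2
    have ha : a.val < n := by omega
    have e1 : (⟨a, ha⟩ : Fin n).castSucc = a := rfl
    have e2 : (⟨a, ha⟩ : Fin n).succ = b := Fin.ext (by simp [h1])
    refine ⟨⟨⟨a, ha⟩, ?_⟩, ?_⟩
    · rw [e1, e2]; exact h2
    · simp only [e1, e2]

/-- The kernel treats a tie as a descent, whereas the original weight ignores it. Injectivity
excludes ties. -/
theorem weight_eq_chainWt {n : ℕ} {t : Fin (n + 1) → ℝ} (ht : Function.Injective t) (lam : ℝ) :
    lam ^ asc t * (lam - 1) ^ des t = chainWt lam t := by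
  classical
  have h1 : des t = (Finset.univ.filter fun i : Fin n => ¬ t i.castSucc < t i.succ).card := by
    rw [des, card_consecutive fun i j => t j < t i]
    congr 1
    ext i
    have : t i.castSucc ≠ t i.succ := fun h => (Fin.castSucc_lt_succ (i := i)).ne (ht h)
    simp only [Finset.mem_filter, Finset.mem_univ, true_and, not_lt]
    exact ⟨le_of_lt, fun h => lt_of_le_of_ne h this.symm⟩
  rw [h1, asc, card_consecutive fun i j => t i < t j]
  simp only [chainWt, kern, Finset.prod_ite, Finset.prod_const]

theorem chainWt_comp {n : ℕ} {α : Type*} [LinearOrder α] {t : Fin (n + 1) → α} (ht : StrictMono t)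
    (σ : Fin (n + 1) → Fin (n + 1)) (lam : ℝ) : chainWt lam (t ∘ σ) = chainWt lam σ := by
  simp only [chainWt, kern, Function.comp_apply, ht.lt_iff_lt]

theorem measurableSet_cube {I : Set ℝ} (hI : MeasurableSet I) (k : ℕ) :
    MeasurableSet (cube I k) := by
  have : cube I k = Set.univ.pi fun _ => I := by ext; simp [cube]
  rw [this]
  exact MeasurableSet.univ_pi fun _ => hI

theorem measurableSet_simplex {I : Set ℝ} (hI : MeasurableSet I) (k : ℕ) :
    MeasurableSet (simplex I k) := by
  refine MeasurableSet.inter (s₁ := {t : Fin k → ℝ | Monotone t}) ?_ (measurableSet_cube hI k)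
  exact isClosed_monotone.measurableSet

theorem measurePreserving_comp_perm {k : ℕ} (σ : Equiv.Perm (Fin k)) :
    MeasurePreserving (fun t : Fin k → ℝ => t ∘ σ) :=
  volume_preserving_arrowCongr' σ.symm (MeasurableEquiv.refl ℝ) (MeasurePreserving.id _)

section Simplex

variable {A : Type*} [NormedRing A] {I : Set ℝ} {h : ℝ → A}

theorem seqProd_indicator (I : Set ℝ) (h : ℝ → A) {k : ℕ} (t : Fin k → ℝ) :
    seqProd (I.indicator h) t = (cube I k).indicator (fun t => orderedProd h t) t := by
  by_cases ht : t ∈ cube I k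
  · rw [Set.indicator_of_mem ht, seqProd, orderedProd]
    simp only [Set.indicator_of_mem (ht _)]
  · rw [Set.indicator_of_notMem ht, seqProd]
    simp only [cube, Set.mem_ofPred_eq, not_forall] at ht
    obtain ⟨i, hi⟩ := ht
    exact List.prod_eq_zero (List.mem_ofFn.mpr ⟨i, Set.indicator_of_notMem hi h⟩)

theorem integrableOn_orderedProd (hI : MeasurableSet I) (hint : IntegrableOn h I) (k : ℕ) :
    IntegrableOn (fun t : Fin k → ℝ => orderedProd h t) (cube I k) := by
  rw [← integrable_indicator_iff (measurableSet_cube hI k)]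
  have := integrable_seqProd ((integrable_indicator_iff hI).mpr hint) k
  rw [funext fun t => seqProd_indicator I h t] at this
  exact this

theorem integrableOn_orderedProd_comp (hI : MeasurableSet I) (hint : IntegrableOn h I) {k : ℕ}
    (σ : Equiv.Perm (Fin k)) :
    IntegrableOn (fun t : Fin k → ℝ => orderedProd h (t ∘ σ)) (cube I k) := by
  have h1 := (measurePreserving_comp_perm σ).integrable_comp_of_integrable
    ((integrable_indicator_iff (measurableSet_cube hI k)).mpr (integrableOn_orderedProd hI hint k))
  rw [← integrable_indicator_iff (measurableSet_cube hI k)]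
  convert h1 using 1
  funext t
  have : t ∘ σ ∈ cube I k ↔ t ∈ cube I k := σ.forall_congr_left.trans (by simp [cube])
  by_cases ht : t ∈ cube I k
  · simp [ht, this.mpr ht]
  · simp [ht, mt this.mp ht]

variable [NormedAlgebra ℝ A]

/-- Almost every point of the cube has distinct coordinates and is therefore sorted by exactly one
permutation. The `k!` permuted copies of the simplex thus tile the cube up to a null set. -/
theorem integral_cube_eq_sum {E : Type*} [NormedAddCommGroup E] [NormedSpace ℝ E] {k : ℕ}
    (hI : MeasurableSet I) {f : (Fin k → ℝ) → E} (hf : IntegrableOn f (cube I k)) :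
    ∫ t in cube I k, f t = ∑ σ : Equiv.Perm (Fin k), ∫ t in simplex I k, f (t ∘ σ) := by
  have hS := measurableSet_simplex hI k
  have hsub : ∀ (σ : Equiv.Perm (Fin k)) (t : Fin k → ℝ), t ∘ σ.symm ∈ simplex I k → t ∈ cube I k :=
    fun σ t ht i => by simpa using ht.2 (σ i)
  have hmeas : ∀ σ : Equiv.Perm (Fin k), MeasurableSet {t : Fin k → ℝ | t ∘ σ.symm ∈ simplex I k} :=
    fun σ => (measurePreserving_comp_perm σ.symm).measurable hS
  have h1 : ∀ σ : Equiv.Perm (Fin k), ∫ t in simplex I k, f (t ∘ σ) =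
      ∫ t, {t : Fin k → ℝ | t ∘ σ.symm ∈ simplex I k}.indicator f t := fun σ => by
    rw [← integral_indicator hS,
      ← (volume_preserving_arrowCongr' σ.symm (MeasurableEquiv.refl ℝ)
        (MeasurePreserving.id _)).integral_comp'
        (fun t => {t : Fin k → ℝ | t ∘ σ.symm ∈ simplex I k}.indicator f t)]
    refine integral_congr_ae (.of_forall fun t => ?_)
    change _ = {t : Fin k → ℝ | t ∘ σ.symm ∈ simplex I k}.indicator f (t ∘ σ)
    have e : t ∘ σ ∈ {t : Fin k → ℝ | t ∘ σ.symm ∈ simplex I k} ↔ t ∈ simplex I k := by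
      change (t ∘ σ) ∘ σ.symm ∈ simplex I k ↔ _
      rw [Function.comp_assoc, Equiv.self_comp_symm, Function.comp_id]
    by_cases ht : t ∈ simplex I k
    · rw [Set.indicator_of_mem ht, Set.indicator_of_mem (e.mpr ht)]
    · rw [Set.indicator_of_notMem ht, Set.indicator_of_notMem (mt e.mp ht)]
  simp only [h1]
  rw [← integral_finsetSum _ fun σ _ => ?_, ← integral_indicator (measurableSet_cube hI k)]
  · refine integral_congr_ae ?_
    filter_upwards [ae_injective k] with t ht
    by_cases hc : t ∈ cube I k
    · have hmem : t ∘ (Tuple.sort t) ∈ simplex I k :=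
        ⟨Tuple.monotone_sort t, fun i => hc _⟩
      rw [Set.indicator_of_mem hc, Finset.sum_eq_single (Tuple.sort t).symm]
      · rw [Set.indicator_of_mem]
        simpa using hmem
      · intro σ _ hσ
        refine Set.indicator_of_notMem (fun hs => hσ ?_) _
        have h2 := Tuple.unique_monotone hs.1 hmem.1
        have h3 : σ.symm = Tuple.sort t :=
          Equiv.ext fun i => ht (congrFun h2 i)
        rw [← h3, Equiv.symm_symm]
      · simp
    · rw [Set.indicator_of_notMem hc, Finset.sum_eq_zero]
      intro σ _
      rw [Set.indicator_of_notMem]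
      exact fun hs => hc (hsub σ t hs)
  · rw [integrable_indicator_iff (hmeas σ)]
    exact hf.mono_set (hsub σ)

/-- The resolvent term as a polynomial in `lam`. -/
theorem resolventTerm_eq_sum (hI : MeasurableSet I) (hint : IntegrableOn h I) (lam : ℝ) (n : ℕ) :
    resolventTerm I h lam (n + 1) = ∑ σ : Equiv.Perm (Fin (n + 1)),
      chainWt lam σ • ∫ t in simplex I (n + 1), orderedProd h (t ∘ σ) := by
  have hS := measurableSet_simplex hI (n + 1)
  have h1 : resolventTerm I h lam (n + 1) =
      ∫ t in cube I (n + 1), chainWt lam t • orderedProd h t := by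
    refine integral_congr_ae (ae_restrict_of_ae ?_)
    filter_upwards [ae_injective (n + 1)] with t ht
    rw [weight_eq_chainWt ht]
  have hm : MeasurableSet {p : ℝ × ℝ | p.1 < p.2} := measurableSet_lt measurable_fst measurable_snd
  have hi : IntegrableOn (fun t => chainWt lam t • orderedProd h t) (cube I (n + 1)) := by
    refine ((integrableOn_orderedProd hI hint (n + 1)).norm.const_mul ((|lam| + 1) ^ n)).mono'
      ((measurable_chainWt hm lam n).aestronglyMeasurable.smul
      (integrableOn_orderedProd hI hint _).aestronglyMeasurable) (.of_forall fun t => ?_)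
    rw [norm_smul, Real.norm_eq_abs, chainWt, Finset.abs_prod]
    refine mul_le_mul_of_nonneg_right ?_ (norm_nonneg _)
    refine (Finset.prod_le_prod (g := fun _ => |lam| + 1) (fun _ _ => abs_nonneg _) fun i _ => ?_).trans_eq (by simp)
    unfold kern
    split_ifs
    · linarith
    · exact (abs_sub _ _).trans (by simp)
  rw [h1, integral_cube_eq_sum hI hi]
  refine Finset.sum_congr rfl fun σ _ => ?_
  rw [← integral_smul]
  -- On the simplex almost every `t` is strictly increasing, so the weight of `t ∘ σ` depends on `σ`
  -- only.
  refine setIntegral_congr_ae hS ?_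
  filter_upwards [ae_injective (n + 1)] with t ht hts
  rw [chainWt_comp (hts.1.strictMono_of_injective ht)]

theorem resTerm_indicator [CompleteSpace A] (hI : MeasurableSet I) (hint : IntegrableOn h I)
    {lam : ℝ} (hl : lam ∈ Set.Icc (0 : ℝ) 1) (n : ℕ) :
    resTerm volume (I.indicator h) lam n = resolventTerm I h lam (n + 1) := by
  rw [resTerm_eq (measurableSet_lt measurable_fst measurable_snd)
    ((integrable_indicator_iff hI).mpr hint) hl, resolventTerm, ← volume_pi,
    ← integral_indicator (measurableSet_cube hI _)]
  refine integral_congr_ae ?_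
  filter_upwards [ae_injective (n + 1)] with t ht
  rw [seqProd_indicator]
  by_cases hc : t ∈ cube I (n + 1)
  · rw [Set.indicator_of_mem hc, Set.indicator_of_mem hc, weight_eq_chainWt ht]
  · rw [Set.indicator_of_notMem hc, Set.indicator_of_notMem hc, smul_zero]

/-- At `lam = 1` a single descent makes the weight vanish, and without descents it is `1`. -/
theorem rexpTerm_eq (hI : MeasurableSet I) (n : ℕ) :
    rexpTerm I h (n + 1) = resolventTerm I h 1 (n + 1) := by
  rw [rexpTerm, resolventTerm, ← integral_indicator (measurableSet_cube hI _),
    ← integral_indicator (measurableSet_simplex hI _)]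
  refine integral_congr_ae ?_
  filter_upwards [ae_injective (n + 1)] with t ht
  by_cases hs : t ∈ simplex I (n + 1)
  · have hc : t ∈ cube I (n + 1) := hs.2
    rw [Set.indicator_of_mem hs, Set.indicator_of_mem hc, weight_eq_chainWt ht]
    have h1 := hs.1.strictMono_of_injective ht
    have : chainWt 1 t = 1 :=
      Finset.prod_eq_one fun i _ => if_pos (h1 Fin.castSucc_lt_succ)
    rw [this, one_smul]
  · rw [Set.indicator_of_notMem hs]
    by_cases hc : t ∈ cube I (n + 1)
    · rw [Set.indicator_of_mem hc, weight_eq_chainWt ht]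
      have h1 : ¬ StrictMono t := fun h1 => hs ⟨h1.monotone, hc⟩
      rw [Fin.strictMono_iff_lt_succ] at h1
      push Not at h1
      obtain ⟨i, hi⟩ := h1
      have : chainWt 1 t = 0 :=
        Finset.prod_eq_zero (Finset.mem_univ i) (by rw [kern, if_neg hi.not_gt, sub_self])
      rw [this, zero_smul]
    · rw [Set.indicator_of_notMem hc]

end Simplex

/-! ### Finite products and the Magnus commutators. -/

theorem contracting_of_integral_norm_lt_one {α : Type*} [MeasurableSpace α] [LinearOrder α]
    {A : Type*} [NormedRing A] [NormedAlgebra ℝ A] {μ : Measure α} [SFinite μ] {g : α → A}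
    (hm : MeasurableSet {p : α × α | p.1 < p.2}) (hg : Integrable g μ) (h1 : ∫ t, ‖g t‖ ∂μ < 1) :
    Contracting μ g (fun n => (∫ t, ‖g t‖ ∂μ) ^ n) where
  summable := summable_geometric_of_lt_one (integral_nonneg fun _ => norm_nonneg _) h1
  bound _ hl _ _ hf n s := (hf.iterate hm hg hl n).bound s

/-- The average of the weight of a chain over `lam ∈ [0, 1]`. -/
noncomputable def meanWt {α : Type*} [LinearOrder α] {n : ℕ} (t : Fin (n + 1) → α) : ℝ :=
  ∫ lam in (0 : ℝ)..1, chainWt lam t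

theorem abs_meanWt_le {α : Type*} [LinearOrder α] {n : ℕ} (t : Fin (n + 1) → α) :
    |meanWt t| ≤ 1 := by
  have h := intervalIntegral.norm_integral_le_of_norm_le_const (a := 0) (b := 1) (C := 1)
    (f := fun lam => chainWt lam t) fun lam hl => by
      rw [Set.uIoc_of_le zero_le_one] at hl
      exact abs_chainWt_le ⟨hl.1.le, hl.2⟩ t
  rw [Real.norm_eq_abs] at h
  simpa [meanWt] using h

section Discrete

variable {A : Type*} [NormedRing A]

/-- `F 0` is the same expression for the indices after `0`, hence the product of the remaining
factors. The full sum is `(1 + y 0) * F 0`. -/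
theorem prod_one_add_eq {k : ℕ} (y F : Fin k → A)
    (hF : ∀ i, F i = 1 + ∑ j, if i < j then y j * F j else 0) :
    1 + ∑ j, y j * F j = (List.ofFn fun i => 1 + y i).prod := by
  induction k with
  | zero => simp
  | succ k ih =>
    have h1 := ih (fun i => y i.succ) (fun i => F i.succ) fun i => by
      rw [hF, Fin.sum_univ_succ]
      simp
    have h0 : F 0 = 1 + ∑ j : Fin k, y j.succ * F j.succ := by
      rw [hF, Fin.sum_univ_succ]
      simp
    rw [List.ofFn_succ, List.prod_cons, ← h1, Fin.sum_univ_succ, h0]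
    noncomm_ring

variable [NormedAlgebra ℝ A] [CompleteSpace A] {k : ℕ}

set_option linter.unusedSectionVars false

theorem integral_pi_count {k n : ℕ} (f : (Fin n → Fin k) → A) :
    ∫ t, f t ∂(Measure.pi fun _ => Measure.count) = ∑ t, f t := by
  rw [integral_fintype .of_finite]
  refine Finset.sum_congr rfl fun t _ => ?_
  rw [measureReal_def, Measure.pi_singleton]
  simp

/-- The operator argument for counting measure on `Fin k`. Here the diagonal has positive mass, so
the value `lam - 1` on ties matters: at `lam = 1` exactly the strictly increasing chains survive,
and these expand the product. -/
theorem hasSum_log_prod (y : Fin k → A) (hy : ∑ i, ‖y i‖ < 1) :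
    HasSum (fun n : ℕ => ∑ t : Fin (n + 1) → Fin k, meanWt t • seqProd y t)
      (log (List.ofFn fun i => 1 + y i).prod) := by
  have hm : MeasurableSet {p : Fin k × Fin k | p.1 < p.2} := .of_discrete
  have hg : Integrable y Measure.count := .of_finite
  have hc := contracting_of_integral_norm_lt_one hm hg (by
    rw [integral_fintype .of_finite]
    simpa [measureReal_def] using hy)
  have hres : ∀ lam ∈ Set.Icc (0 : ℝ) 1, ∀ n, resTerm Measure.count y lam n =
      ∑ t : Fin (n + 1) → Fin k, chainWt lam t • seqProd y t := fun lam hl n => by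
    rw [resTerm_eq hm hg hl, integral_pi_count]
  have hcont : ∀ n, Continuous fun lam => ∑ t : Fin (n + 1) → Fin k, chainWt lam t • seqProd y t :=
    fun n => continuous_finsetSum _ fun t _ => (continuous_chainWt t).smul continuous_const
  have h := hc.hasSum_log hm hg fun n => (hcont n).continuousOn.congr fun lam hl => hres lam hl n
  have hE : 1 + resSum Measure.count y 1 = (List.ofFn fun i => 1 + y i).prod := by
    rw [resSum, integral_fintype .of_finite]
    simp only [measureReal_def, Measure.count_singleton, ENNReal.toReal_one, one_smul]
    refine prod_one_add_eq y _ fun i => ?_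
    rw [hc.resSol_eq hm hg (by simp) i, volterra, integral_fintype .of_finite]
    simp [measureReal_def, kern, ite_smul]
  rw [hE] at h
  convert h using 2 with n
  rw [intervalIntegral.integral_congr (g := fun lam => ∑ t : Fin (n + 1) → Fin k,
    chainWt lam t • seqProd y t), intervalIntegral.integral_finsetSum]
  · refine Finset.sum_congr rfl fun t _ => ?_
    rw [intervalIntegral.integral_smul_const, meanWt]
  · exact fun t _ => ((continuous_chainWt t).smul continuous_const).intervalIntegrable _ _
  · intro lam hl
    rw [Set.uIcc_of_le zero_le_one] at hl
    exact hres lam hl n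

/-- The power series of `y ↦ log ((1 + y 0) ⋯ (1 + y (k - 1)))` at zero. -/
noncomputable def logProdSeries (A : Type*) [NormedRing A] [NormedAlgebra ℝ A] (k : ℕ) :
    FormalMultilinearSeries ℝ (Fin k → A) A
  | 0 => 0
  | n + 1 => ∑ t : Fin (n + 1) → Fin k, meanWt t •
      (ContinuousMultilinearMap.mkPiAlgebraFin ℝ (n + 1) A).compContinuousLinearMap
        (fun j => ContinuousLinearMap.proj (t j))

theorem logProdSeries_succ_apply (n : ℕ) (v : Fin (n + 1) → Fin k → A) :
    logProdSeries A k (n + 1) v =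
      ∑ t : Fin (n + 1) → Fin k, meanWt t • (List.ofFn fun j => v j (t j)).prod := by
  simp [logProdSeries]

theorem norm_logProdSeries_le (n : ℕ) : ‖logProdSeries A k n‖ ≤ (k : ℝ) ^ n := by
  refine ContinuousMultilinearMap.opNorm_le_bound (by positivity) fun v => ?_
  cases n with
  | zero => simp [logProdSeries]
  | succ n =>
    rw [logProdSeries_succ_apply]
    refine (norm_sum_le _ _).trans ((Finset.sum_le_card_nsmul _ _ (∏ i, ‖v i‖)
      fun t _ => ?_).trans_eq (by simp))
    rw [norm_smul, Real.norm_eq_abs]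
    refine (mul_le_of_le_one_left (norm_nonneg _) (abs_meanWt_le t)).trans ?_
    refine (List.norm_prod_le' (by simp)).trans ?_
    rw [List.map_ofFn, List.prod_ofFn]
    exact Finset.prod_le_prod (fun _ _ => norm_nonneg _) fun i _ => norm_le_pi_norm (v i) (t i)

theorem hasFPowerSeriesAt_log_prod :
    HasFPowerSeriesAt (fun y : Fin k → A => log (List.ofFn fun i => 1 + y i).prod)
      (logProdSeries A k) 0 := by
  -- On this sup-norm ball `∑ ‖y i‖ ≤ k / (k + 1) < 1`.
  have hr : (0 : ℝ) < ((k : ℝ) + 1)⁻¹ := by positivity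
  let r : NNReal := ⟨((k : ℝ) + 1)⁻¹, hr.le⟩
  refine ⟨r, ⟨FormalMultilinearSeries.le_radius_of_bound _ 1 fun n => ?_, ?_, fun {y} hy => ?_⟩⟩
  · calc _ ≤ (k : ℝ) ^ n * (((k : ℝ) + 1)⁻¹) ^ n := by
          gcongr
          · exact norm_logProdSeries_le n
          · exact le_rfl
      _ = ((k : ℝ) / (k + 1)) ^ n := by rw [← mul_pow, div_eq_mul_inv]
      _ ≤ 1 := pow_le_one₀ (by positivity) (div_le_one_of_le₀ (by linarith) (by positivity))
  · exact ENNReal.coe_pos.mpr hr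
  · have hy1 : ‖y‖ < ((k : ℝ) + 1)⁻¹ := by
      rw [Metric.eball_coe, mem_ball_zero_iff] at hy
      exact hy
    have hy2 : ∑ i, ‖y i‖ < 1 := by
      calc ∑ i, ‖y i‖ ≤ ∑ _i : Fin k, ((k : ℝ) + 1)⁻¹ :=
            Finset.sum_le_sum fun i _ => (norm_le_pi_norm y i).trans hy1.le
        _ = k / (k + 1) := by simp [div_eq_mul_inv]
        _ < 1 := by rw [div_lt_one (by positivity)]; linarith
    rw [zero_add, ← hasSum_nat_add_iff' 1]
    have := hasSum_log_prod y hy2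
    simp only [Finset.range_one, Finset.sum_singleton, logProdSeries_succ_apply]
    simpa [logProdSeries, seqProd] using this

/-- The power series of `t ↦ exp (t i • x) - 1` at zero. -/
noncomputable def coordExpSeries (x : A) (i : Fin k) : FormalMultilinearSeries ℝ (Fin k → ℝ) A :=
  (NormedSpace.expSeries ℝ A).compContinuousLinearMap
    ((ContinuousLinearMap.proj (R := ℝ) (φ := fun _ : Fin k => ℝ) i).smulRight x) -
  constFormalMultilinearSeries ℝ (Fin k → ℝ) (1 : A)

theorem hasFPowerSeriesAt_coordExp (x : A) (i : Fin k) :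
    HasFPowerSeriesAt (fun t : Fin k → ℝ => NormedSpace.exp (t i • x) - 1)
      (coordExpSeries x i) 0 := by
  refine HasFPowerSeriesAt.sub ?_ hasFPowerSeriesAt_const
  refine HasFPowerSeriesAt.compContinuousLinearMap (f := NormedSpace.exp)
    (u := (ContinuousLinearMap.proj (R := ℝ) (φ := fun _ : Fin k => ℝ) i).smulRight x) ?_
  simpa using NormedSpace.exp_hasFPowerSeriesAt_zero (𝕂 := ℝ) (𝔸 := A)

theorem coordExpSeries_apply (x : A) (i : Fin k) {m : ℕ} (hm : m ≠ 0) (v : Fin m → Fin k → ℝ) :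
    coordExpSeries x i m v = (m.factorial⁻¹ : ℝ) • (List.ofFn fun j => v j i • x).prod := by
  simp [coordExpSeries, NormedSpace.expSeries, constFormalMultilinearSeries_apply_of_nonzero hm,
    FormalMultilinearSeries.compContinuousLinearMap_apply, Function.comp_def]

/-- The `i`-th exponential depends on the coordinate `i` alone. A block of length at least two feeds
it two different unit vectors and gives zero, so only the composition into singletons contributes.
In that term only the index tuple `σ` survives. -/
theorem comp_apply_single {n : ℕ} (X : Fin (n + 1) → A) (σ : Equiv.Perm (Fin (n + 1))) :
    ((logProdSeries A (n + 1)).comp (FormalMultilinearSeries.pi fun i => coordExpSeries (X i) i))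
      (n + 1) (fun i => Pi.single (σ i) 1) = meanWt σ • seqProd X σ := by
  set p := FormalMultilinearSeries.pi fun i => coordExpSeries (X i) i with hp
  have hpm : ∀ {m : ℕ}, m ≠ 0 → ∀ (v : Fin m → Fin (n + 1) → ℝ) i,
      p m v i = (m.factorial⁻¹ : ℝ) • (List.ofFn fun j => v j i • X i).prod := fun hm v i =>
    coordExpSeries_apply (X i) i hm v
  have h1 : ∀ s : Fin (n + 1), p 1 (fun _ => Pi.single s 1) = Pi.single s (X s) := fun s => by
    funext i
    rw [hpm one_ne_zero]
    by_cases his : i = s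
    · subst his; simp
    · simp [his]
  rw [FormalMultilinearSeries.comp, _root_.sum_apply,
    Finset.sum_eq_single (Composition.ones (n + 1))]
  · rw [FormalMultilinearSeries.compAlongComposition_apply,
      FormalMultilinearSeries.applyComposition_ones]
    have h2 : logProdSeries A (n + 1) (Composition.ones (n + 1)).length
        (fun i => p 1 fun _ => Pi.single (σ (Fin.castLE (Composition.length_le _) i)) 1) =
        logProdSeries A (n + 1) (n + 1) (fun i => p 1 fun _ => Pi.single (σ i) 1) :=
      FormalMultilinearSeries.congr _ (Composition.ones_length _) fun i hi1 hi2 => rfl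
    rw [h2, logProdSeries_succ_apply, Finset.sum_eq_single (σ : Fin (n + 1) → Fin (n + 1))]
    · simp [h1, seqProd]
    · intro t _ ht
      obtain ⟨j, hj⟩ := Function.ne_iff.mp ht
      rw [List.prod_eq_zero, smul_zero]
      exact List.mem_ofFn.mpr ⟨j, by simp [h1, hj]⟩
    · simp
  · intro c _ hc
    obtain ⟨b, hb, hb1⟩ := Composition.ne_ones_iff.mp hc
    obtain ⟨i, hi, rfl⟩ := List.mem_iff_getElem.mp hb
    rw [FormalMultilinearSeries.compAlongComposition_apply]
    refine ContinuousMultilinearMap.map_coord_zero _ (⟨i, hi⟩ : Fin c.length) ?_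
    have hb2 : 1 < c.blocksFun ⟨i, hi⟩ := hb1
    rw [FormalMultilinearSeries.applyComposition]
    funext l
    rw [hpm (by omega), List.prod_eq_zero, smul_zero, Pi.zero_apply]
    rw [List.mem_ofFn]
    by_contra hne
    push Not at hne
    have h3 : ∀ j, σ (c.embedding ⟨i, hi⟩ j) = l := fun j => by
      by_contra h
      exact hne j (by simp [Ne.symm h])
    have h4 := (c.embedding ⟨i, hi⟩).injective (σ.injective ((h3 ⟨0, by omega⟩).trans (h3 ⟨1, hb2⟩).symm))
    simp at h4
  · simp

/-- The Magnus commutator as a sum over permutations. -/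
theorem magnusCommutator_eq_sum {n : ℕ} (X : Fin (n + 1) → A) :
    magnusCommutator X = ∑ σ : Equiv.Perm (Fin (n + 1)), meanWt σ • seqProd X σ := by
  have h1 : HasFPowerSeriesAt (fun (t : Fin (n + 1) → ℝ) i => NormedSpace.exp (t i • X i) - 1)
      (FormalMultilinearSeries.pi fun i => coordExpSeries (X i) i) 0 :=
    HasFPowerSeriesAt.pi fun i => hasFPowerSeriesAt_coordExp (X i) i
  have h2 : (fun i => NormedSpace.exp ((0 : Fin (n + 1) → ℝ) i • X i) - 1) = 0 := by
    funext i
    simp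
  have h3 := HasFPowerSeriesAt.comp
    (f := fun (t : Fin (n + 1) → ℝ) i => NormedSpace.exp (t i • X i) - 1) (x := 0)
    (by rw [h2]; exact hasFPowerSeriesAt_log_prod (A := A)) h1
  obtain ⟨r, hr⟩ := h3
  -- The iterated derivative symmetrizes the power series coefficient, which is where the sum over
  -- permutations comes from.
  have h4 := hr.iteratedFDeriv_eq_sum_of_completeSpace (n := n + 1) (fun i => Pi.single i 1)
  simp only [comp_apply_single] at h4
  rw [← h4, magnusCommutator]
  congr 2
  funext t
  simp

end Discrete

/-! ### Magnus terms as means of resolvent terms. -/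

section MagnusTerm

variable {A : Type*} [NormedRing A] [NormedAlgebra ℝ A] [CompleteSpace A] {I : Set ℝ} {h : ℝ → A}

theorem integrableOn_magnusCommutator (hI : MeasurableSet I) (hint : IntegrableOn h I) (k : ℕ) :
    IntegrableOn (fun t : Fin k → ℝ => magnusCommutator fun i => h (t i)) (simplex I k) := by
  cases k with
  | zero =>
    have : (fun t : Fin 0 → ℝ => magnusCommutator fun i => h (t i)) =
        fun _ => magnusCommutator fun i : Fin 0 => i.elim0 := by
      funext t
      congr 1
      funext i
      exact i.elim0
    rw [this, volume_pi, Measure.pi_of_empty (fun _ : Fin 0 => (volume : Measure ℝ))]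
    exact (integrable_const _).integrableOn
  | succ n =>
    simp only [magnusCommutator_eq_sum]
    exact integrable_finsetSum _ fun σ _ => by
      exact ((integrableOn_orderedProd_comp hI hint σ).mono_set
        fun t (ht : t ∈ simplex I _) => ht.2).smul (meanWt σ)

/-- Both sides are the same combination of integrals over the simplex indexed by permutations.
Averaging the coefficient `chainWt lam σ` over `lam` gives `meanWt σ`. -/
theorem magnusTerm_eq (hI : MeasurableSet I) (hint : IntegrableOn h I) (n : ℕ) :
    magnusTerm I h (n + 1) = ∫ lam in (0 : ℝ)..1, resolventTerm I h lam (n + 1) := by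
  simp only [magnusTerm, magnusCommutator_eq_sum, resolventTerm_eq_sum hI hint]
  rw [integral_finsetSum, intervalIntegral.integral_finsetSum]
  · refine Finset.sum_congr rfl fun σ _ => ?_
    rw [intervalIntegral.integral_smul_const, integral_smul]
    rfl
  · exact fun σ _ => ((continuous_chainWt _).smul continuous_const).intervalIntegrable _ _
  · intro σ _
    exact ((integrableOn_orderedProd_comp hI hint σ).mono_set
      fun t (ht : t ∈ simplex I _) => ht.2).smul (meanWt σ)

end MagnusTerm

/-! ### The scalar inequality behind the exponential weight. -/

theorem exp_two_mul_mul_one_sub_le {x : ℝ} (h0 : 0 ≤ x) (h1 : x ≤ 1) :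
    Real.exp (2 * (x + x ^ 3 / 3)) * (1 - x) ≤ 1 + x := by
  rcases h1.eq_or_lt with rfl | h1
  · norm_num
  have h := Real.hasSum_log_sub_log_of_abs_lt_one (x := x) (by rwa [abs_of_nonneg h0])
  -- Two terms of the series of `log ((1 + x) / (1 - x))`, all of whose terms are nonnegative.
  -- Unlike the full series, this truncation stays finite at `x = 1`.
  have h2 := sum_le_hasSum (Finset.range 2) (fun i _ => by positivity) h
  have h3 : 2 * (x + x ^ 3 / 3) ≤ Real.log (1 + x) - Real.log (1 - x) := by
    refine le_trans (le_of_eq ?_) h2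
    simp [Finset.sum_range_succ]
    ring
  have hp : 0 < 1 - x := by linarith
  rw [← Real.log_div (by linarith) hp.ne', Real.le_log_iff_exp_le (by positivity), le_div_iff₀ hp]
    at h3
  exact h3

/-- The value of the scalar operator on the exponential weight. -/
theorem weight_inequality {lam : ℝ} (hl : lam ∈ Set.Icc (0 : ℝ) 1) {x κ : ℝ}
    (hx : x = 2 * lam - 1) (hx0 : x ≠ 0) (hκ : κ = x + x ^ 3 / 3) (E : ℝ) :
    lam * ((E - Real.exp (-κ * 2)) / κ) + (1 - lam) * ((1 - E) / κ) ≤ (1 + x ^ 2 / 3)⁻¹ * E := by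
  have hκx : κ = x * (1 + x ^ 2 / 3) := by rw [hκ]; ring
  have hpos : 0 < 1 + x ^ 2 / 3 := by positivity
  have hκ0 : κ ≠ 0 := by rw [hκx]; exact mul_ne_zero hx0 hpos.ne'
  have e1 : (1 + x ^ 2 / 3)⁻¹ = x / κ := by rw [hκx]; field_simp
  have e2 : lam * ((E - Real.exp (-κ * 2)) / κ) + (1 - lam) * ((1 - E) / κ) =
      x / κ * E + ((1 - lam) - lam * Real.exp (-κ * 2)) / κ := by
    rw [hx]; field_simp; ring
  rw [e1, e2]
  have e3 : Real.exp (2 * κ) * Real.exp (-κ * 2) = 1 := by rw [← Real.exp_add]; ring_nf; simp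
  have hE2 := Real.exp_pos (-κ * 2)
  have hE1 := Real.exp_pos (2 * κ)
  -- The term in `E` already has the contraction factor `x / κ`. For `x > 0` the remainder is
  -- nonpositive exactly when `exp (2κ) (1 - x) ≤ 1 + x`; for `x < 0` use the same with `-x`.
  suffices ((1 - lam) - lam * Real.exp (-κ * 2)) / κ ≤ 0 by linarith
  rcases lt_or_gt_of_ne hx0 with hneg | hxpos
  · refine div_nonpos_of_nonneg_of_nonpos ?_ (by rw [hκx]; exact (mul_neg_of_neg_of_pos hneg hpos).le)
    have h := exp_two_mul_mul_one_sub_le (x := -x) (by linarith) (by linarith [hl.1])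
    have e4 : 2 * (-x + (-x) ^ 3 / 3) = -κ * 2 := by rw [hκ]; ring
    rw [e4] at h
    nlinarith
  · refine div_nonpos_of_nonpos_of_nonneg ?_ (by rw [hκx]; exact (mul_pos hxpos hpos).le)
    have h := exp_two_mul_mul_one_sub_le hxpos.le (by linarith [hl.2])
    rw [← hκ] at h
    have := mul_le_mul_of_nonneg_right h hE2.le
    rw [mul_right_comm, e3] at this
    nlinarith

/-! ### The cumulative norm as a change of variable. -/

section Cumulative

variable {A : Type*} [NormedRing A] {g : ℝ → A}

/-- The cumulative norm `∫_{t ≤ s} ‖g t‖`. -/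
noncomputable def cumNorm (g : ℝ → A) (s : ℝ) : ℝ := ∫ t in Set.Iic s, ‖g t‖

theorem cumNorm_sub (hg : Integrable g) (a b : ℝ) :
    cumNorm g b - cumNorm g a = ∫ t in a..b, ‖g t‖ :=
  intervalIntegral.integral_Iic_sub_Iic hg.norm.integrableOn hg.norm.integrableOn

theorem continuous_cumNorm (hg : Integrable g) : Continuous (cumNorm g) := by
  have h : cumNorm g = fun s => cumNorm g 0 + ∫ t in (0 : ℝ)..s, ‖g t‖ := by
    funext s
    rw [← cumNorm_sub hg]
    ring
  rw [h]
  exact continuous_const.add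
    (intervalIntegral.continuous_primitive (fun _ _ => hg.norm.intervalIntegrable) 0)

theorem monotone_cumNorm (hg : Integrable g) : Monotone (cumNorm g) := fun a b hab => by
  rw [← sub_nonneg, cumNorm_sub hg]
  exact intervalIntegral.integral_nonneg hab fun _ _ => norm_nonneg _

theorem cumNorm_nonneg (g : ℝ → A) (s : ℝ) : 0 ≤ cumNorm g s :=
  integral_nonneg fun _ => norm_nonneg _

theorem cumNorm_le (hg : Integrable g) (s : ℝ) : cumNorm g s ≤ ∫ t, ‖g t‖ :=
  setIntegral_le_integral hg.norm (.of_forall fun _ => norm_nonneg _)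

theorem tendsto_cumNorm_atTop (hg : Integrable g) :
    Filter.Tendsto (cumNorm g) Filter.atTop (nhds (∫ t, ‖g t‖)) := by
  have h := (aecover_Iic (μ := volume) Filter.tendsto_id).integral_tendsto_of_countably_generated
    hg.norm
  exact h

theorem tendsto_cumNorm_atBot (hg : Integrable g) :
    Filter.Tendsto (cumNorm g) Filter.atBot (nhds 0) := by
  have h := (aecover_Ioi (μ := volume) (a := (id : ℝ → ℝ)) Filter.tendsto_id).integral_tendsto_of_countably_generated
    hg.norm
  have h2 : cumNorm g = fun s => (∫ t, ‖g t‖) - ∫ t in Set.Ioi s, ‖g t‖ := by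
    funext s
    rw [← intervalIntegral.integral_Iic_add_Ioi (b := s) hg.norm.integrableOn hg.norm.integrableOn,
      cumNorm]
    ring
  rw [h2]
  simpa using h.const_sub (∫ t, ‖g t‖)

/-- The measure with density `‖g‖`. -/
noncomputable def normMeasure (g : ℝ → A) : Measure ℝ :=
  volume.withDensity fun t => ‖g t‖ₑ

theorem normMeasure_apply (hg : Integrable g) {s : Set ℝ} (hs : MeasurableSet s) :
    normMeasure g s = ENNReal.ofReal (∫ t in s, ‖g t‖) := by
  rw [normMeasure, withDensity_apply _ hs, ofReal_integral_norm_eq_lintegral_enorm hg.integrableOn]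

/-- Half-lines determine the measure. The cumulative norm is monotone and continuous with every
value strictly between `0` and the total, so preimages of half-lines can be compared with
half-lines. -/
theorem map_cumNorm (hg : Integrable g) :
    (normMeasure g).map (cumNorm g) = volume.restrict (Set.Ioc 0 (∫ t, ‖g t‖)) := by
  have hu := (continuous_cumNorm hg).measurable
  have huniv : normMeasure g Set.univ = ENNReal.ofReal (∫ t, ‖g t‖) := by
    rw [normMeasure_apply hg .univ, Measure.restrict_univ]
  have : IsFiniteMeasure (normMeasure g) := ⟨by rw [huniv]; exact ENNReal.ofReal_lt_top⟩
  have hIic : ∀ s, normMeasure g (Set.Iic s) = ENNReal.ofReal (cumNorm g s) := fun s =>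
    normMeasure_apply hg measurableSet_Iic
  set m := ∫ t, ‖g t‖ with hm
  have hsurj : ∀ x, 0 < x → x < m → ∃ s, cumNorm g s = x := fun x h0 h1 => by
    obtain ⟨a, ha⟩ := ((tendsto_cumNorm_atBot hg).eventually (gt_mem_nhds h0)).exists
    obtain ⟨b, hb⟩ := ((tendsto_cumNorm_atTop hg).eventually (lt_mem_nhds h1)).exists
    exact mem_range_of_exists_le_of_exists_ge (continuous_cumNorm hg) ⟨a, ha.le⟩ ⟨b, hb.le⟩
  refine Measure.ext_of_Iic _ _ fun x => ?_
  rw [Measure.map_apply hu measurableSet_Iic, Measure.restrict_apply measurableSet_Iic]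
  have hI : Set.Iic x ∩ Set.Ioc 0 m = Set.Ioc 0 (min x m) := by
    ext y
    simp only [Set.mem_inter_iff, Set.mem_Iic, Set.mem_Ioc, le_min_iff]
    tauto
  rw [hI, Real.volume_Ioc, sub_zero]
  rcases lt_or_ge x 0 with hx | hx
  · have : cumNorm g ⁻¹' Set.Iic x = ∅ := by
      ext s
      simpa using lt_of_lt_of_le hx (cumNorm_nonneg g s)
    rw [this, measure_empty, ENNReal.ofReal_of_nonpos ((min_le_left _ _).trans hx.le)]
  rcases le_or_gt m x with hxm | hxm
  · have : cumNorm g ⁻¹' Set.Iic x = Set.univ := by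
      ext s
      simpa using (cumNorm_le hg s).trans hxm
    rw [this, huniv, min_eq_right hxm]
  rw [min_eq_left hxm.le]
  apply le_antisymm
  · have h1 : ∀ᶠ y in nhdsWithin x (Set.Ioi x),
        normMeasure g (cumNorm g ⁻¹' Set.Iic x) ≤ ENNReal.ofReal y := by
      filter_upwards [Ioo_mem_nhdsGT hxm] with y hy
      obtain ⟨s, rfl⟩ := hsurj y (lt_of_le_of_lt hx hy.1) hy.2
      rw [← hIic]
      exact measure_mono fun t ht =>
        ((monotone_cumNorm hg).reflect_lt (lt_of_le_of_lt ht hy.1)).le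
    exact ge_of_tendsto ((ENNReal.continuous_ofReal.tendsto x).mono_left nhdsWithin_le_nhds) h1
  · rcases hx.eq_or_lt with rfl | hx0
    · simp
    · obtain ⟨s, rfl⟩ := hsurj x hx0 hxm
      rw [← hIic]
      exact measure_mono fun t ht => monotone_cumNorm hg ht

theorem integral_norm_mul_comp_cumNorm (hg : Integrable g) {ψ : ℝ → ℝ} (hψ : Measurable ψ) :
    ∫ t, ‖g t‖ * ψ (cumNorm g t) = ∫ x in Set.Ioc 0 (∫ t, ‖g t‖), ψ x := by
  rw [← map_cumNorm hg, integral_map (continuous_cumNorm hg).measurable.aemeasurable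
    hψ.aestronglyMeasurable]
  exact (integral_withDensity_eq_integral_smul₀ (μ := volume) (f := fun t => ‖g t‖₊)
    hg.aestronglyMeasurable.nnnorm.aemeasurable (fun t => ψ (cumNorm g t))).symm

theorem setIntegral_Ioi_norm_mul_comp_cumNorm (hg : Integrable g) {φ : ℝ → ℝ} (hφ : Continuous φ)
    (s : ℝ) : ∫ t in Set.Ioi s, ‖g t‖ * φ (cumNorm g t) =
      ∫ x in cumNorm g s..∫ t, ‖g t‖, φ x := by
  set m := ∫ t, ‖g t‖ with hm
  -- The image measure has no atoms, so `g` vanishes almost everywhere on the level set of `cumNorm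
  -- g s`. Off it, `s < t` can be read off from the cumulative norms.
  have hnull : ∀ᵐ t, ‖g t‖ = 0 ∨ cumNorm g t ≠ cumNorm g s := by
    have h : (normMeasure g).map (cumNorm g) {cumNorm g s} = 0 := by
      rw [map_cumNorm hg]
      exact measure_singleton _
    rw [Measure.map_apply (continuous_cumNorm hg).measurable (measurableSet_singleton _)] at h
    have h2 := measure_eq_zero_iff_ae_notMem.mp h
    rw [normMeasure, ae_withDensity_iff' hg.aestronglyMeasurable.enorm] at h2
    filter_upwards [h2] with t ht
    by_cases h0 : ‖g t‖ = 0
    · exact .inl h0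
    · exact .inr (ht (by simpa using h0))
  calc ∫ t in Set.Ioi s, ‖g t‖ * φ (cumNorm g t)
      = ∫ t, ‖g t‖ * (Set.Ioi (cumNorm g s)).indicator φ (cumNorm g t) := by
        rw [← integral_indicator measurableSet_Ioi]
        refine integral_congr_ae ?_
        filter_upwards [hnull] with t ht
        rcases ht with ht | ht
        · simp [Set.indicator, ht]
        have : t ∈ Set.Ioi s ↔ cumNorm g t ∈ Set.Ioi (cumNorm g s) :=
          ⟨fun h => lt_of_le_of_ne (monotone_cumNorm hg (le_of_lt h)) ht.symm,
            fun h => (monotone_cumNorm hg).reflect_lt h⟩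
        by_cases hs : t ∈ Set.Ioi s
        · rw [Set.indicator_of_mem hs, Set.indicator_of_mem (this.mp hs)]
        · rw [Set.indicator_of_notMem hs, Set.indicator_of_notMem (mt this.mpr hs), mul_zero]
    _ = ∫ x in cumNorm g s..m, φ x := by
        rw [integral_norm_mul_comp_cumNorm hg (hφ.measurable.indicator measurableSet_Ioi),
          integral_indicator measurableSet_Ioi, Measure.restrict_restrict measurableSet_Ioi,
          intervalIntegral.integral_of_le (cumNorm_le hg s)]
        congr 2
        ext y
        simp only [Set.mem_inter_iff, Set.mem_Ioi, Set.mem_Ioc]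
        exact ⟨fun h => ⟨h.1, h.2.2⟩, fun h => ⟨h.1, lt_of_le_of_lt (cumNorm_nonneg g s) h.1, h.2⟩⟩

theorem setIntegral_Iic_norm_mul_comp_cumNorm (hg : Integrable g) {φ : ℝ → ℝ} (hφ : Continuous φ)
    (s : ℝ) (hi : Integrable fun t => ‖g t‖ * φ (cumNorm g t)) :
    ∫ t in Set.Iic s, ‖g t‖ * φ (cumNorm g t) = ∫ x in (0 : ℝ)..cumNorm g s, φ x := by
  have h1 := intervalIntegral.integral_Iic_add_Ioi (b := s) hi.integrableOn hi.integrableOn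
  have h2 := setIntegral_Ioi_norm_mul_comp_cumNorm hg hφ s
  have h3 := integral_norm_mul_comp_cumNorm hg hφ.measurable
  rw [← intervalIntegral.integral_of_le (integral_nonneg fun _ => norm_nonneg _)] at h3
  have h4 := intervalIntegral.integral_add_adjacent_intervals
    (hφ.intervalIntegrable (μ := volume) 0 (cumNorm g s))
    (hφ.intervalIntegrable (cumNorm g s) (∫ t, ‖g t‖))
  linarith

end Cumulative

/-! ### Contraction away from `λ = 1/2`. -/

section Far

variable {A : Type*} [NormedRing A] [NormedAlgebra ℝ A] {g : ℝ → A}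

theorem integral_exp_neg_mul {κ : ℝ} (hκ : κ ≠ 0) (a b : ℝ) :
    ∫ x in a..b, Real.exp (-κ * x) = (Real.exp (-κ * a) - Real.exp (-κ * b)) / κ := by
  rw [intervalIntegral.integral_comp_mul_left (fun x => Real.exp x) (neg_ne_zero.mpr hκ),
    integral_exp, smul_eq_mul]
  field_simp
  ring

/-- In the variable `cumNorm g t` the norm of the integrand becomes an exponential on `[0, 2]`, with
coefficient `1 - lam` below `cumNorm g s` and `lam` above it. This leaves `weight_inequality`. -/
theorem norm_volterra_le_weight (hg : Integrable g) (hg2 : ∫ t, ‖g t‖ = 2) {lam : ℝ}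
    (hl : lam ∈ Set.Icc (0 : ℝ) 1) {x κ : ℝ} (hx : x = 2 * lam - 1) (hx0 : x ≠ 0)
    (hκ : κ = x + x ^ 3 / 3) {f : ℝ → A} {B : ℝ}
    (hf : ∀ t, ‖f t‖ ≤ B * Real.exp (-κ * cumNorm g t)) (hB : 0 ≤ B) (s : ℝ) :
    ‖volterra volume g lam f s‖ ≤
      (B * (1 + x ^ 2 / 3)⁻¹) * Real.exp (-κ * cumNorm g s) := by
  have hκx : κ = x * (1 + x ^ 2 / 3) := by rw [hκ]; ring
  have hκ0 : κ ≠ 0 := by rw [hκx]; exact mul_ne_zero hx0 (by positivity)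
  have hφ : Continuous fun x => Real.exp (-κ * x) := by fun_prop
  have hi : Integrable fun t => ‖g t‖ * Real.exp (-κ * cumNorm g t) := by
    refine (hg.norm.mul_const (Real.exp (|κ| * 2))).mono' (hg.norm.aestronglyMeasurable.mul
      (hφ.comp (continuous_cumNorm hg)).aestronglyMeasurable) (.of_forall fun t => ?_)
    rw [norm_mul, norm_norm, Real.norm_eq_abs, Real.abs_exp]
    gcongr
    · exact cumNorm_nonneg g t
    · exact neg_le_abs κ
    · exact hg2 ▸ cumNorm_le hg t
  have h1 := setIntegral_Ioi_norm_mul_comp_cumNorm hg hφ s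
  have h2 := setIntegral_Iic_norm_mul_comp_cumNorm hg hφ s hi
  rw [integral_exp_neg_mul hκ0, hg2] at h1
  rw [integral_exp_neg_mul hκ0, mul_zero, Real.exp_zero] at h2
  set E := Real.exp (-κ * cumNorm g s)
  have hnn : ∀ t, 0 ≤ B * (‖g t‖ * Real.exp (-κ * cumNorm g t)) := fun t => by positivity
  have hk1 : ∀ t ∈ Set.Iic s, |kern lam s t| = 1 - lam := fun t ht => by
    rw [kern, if_neg (not_lt.mpr (Set.mem_Iic.mp ht)), abs_of_nonpos (by linarith [hl.2]), neg_sub]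
  have hk2 : ∀ t ∈ Set.Ioi s, |kern lam s t| = lam := fun t ht => by
    rw [kern, if_pos (Set.mem_Ioi.mp ht), abs_of_nonneg hl.1]
  have h3 : ‖volterra volume g lam f s‖ ≤
      ∫ t, |kern lam s t| * (B * (‖g t‖ * Real.exp (-κ * cumNorm g t))) := by
    refine norm_integral_le_of_norm_le ?_ (.of_forall fun t => ?_)
    · refine (hi.const_mul B).mono' ((((measurable_kern (measurableSet_lt measurable_fst
        measurable_snd) lam).comp measurable_prodMk_left).norm.aestronglyMeasurable).mul
        (hi.const_mul B).aestronglyMeasurable) (.of_forall fun t => ?_)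
      rw [norm_mul, Real.norm_eq_abs, Real.norm_eq_abs, abs_abs, abs_of_nonneg (hnn t)]
      exact mul_le_of_le_one_left (hnn t) (abs_kern_le hl _ _)
    · rw [norm_smul, Real.norm_eq_abs]
      gcongr
      calc _ ≤ ‖g t‖ * ‖f t‖ := norm_mul_le _ _
        _ ≤ ‖g t‖ * (B * Real.exp (-κ * cumNorm g t)) := by gcongr; exact hf t
        _ = _ := by ring
  refine h3.trans ?_
  have h4 : ∫ t, |kern lam s t| * (B * (‖g t‖ * Real.exp (-κ * cumNorm g t))) =
      (1 - lam) * (B * ((1 - E) / κ)) + lam * (B * ((E - Real.exp (-κ * 2)) / κ)) := by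
    rw [← h1, ← h2, ← integral_const_mul, ← integral_const_mul, ← integral_const_mul,
      ← integral_const_mul]
    rw [← intervalIntegral.integral_Iic_add_Ioi (b := s)]
    · congr 1
      · refine setIntegral_congr_fun measurableSet_Iic fun t ht => ?_
        simp only [hk1 t ht]
      · refine setIntegral_congr_fun measurableSet_Ioi fun t ht => ?_
        simp only [hk2 t ht]
    · refine ((hi.const_mul B).const_mul (1 - lam)).integrableOn.congr_fun (fun t ht => ?_)
        measurableSet_Iic
      simp only [hk1 t ht]
    · refine ((hi.const_mul B).const_mul lam).integrableOn.congr_fun (fun t ht => ?_)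
        measurableSet_Ioi
      simp only [hk2 t ht]
  rw [h4]
  have h5 := mul_le_mul_of_nonneg_left (weight_inequality hl hx hx0 hκ E) hB
  linarith

theorem norm_volterra_iterate_far (hg : Integrable g) (hg2 : ∫ t, ‖g t‖ = 2) {lam η : ℝ}
    (hl : lam ∈ Set.Icc (0 : ℝ) 1) (hη : 0 < η) (hx : η ≤ |2 * lam - 1|)
    {f : ℝ → A} {B : ℝ} (hf : ∀ t, ‖f t‖ ≤ B) (n : ℕ) (s : ℝ) :
    ‖(volterra volume g lam)^[n] f s‖ ≤
      Real.exp (16 / 3) * (1 + η ^ 2 / 3)⁻¹ ^ n * B := by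
  obtain ⟨x, hxd⟩ : ∃ x, x = 2 * lam - 1 := ⟨_, rfl⟩
  obtain ⟨κ, hκ⟩ : ∃ κ, κ = x + x ^ 3 / 3 := ⟨_, rfl⟩
  rw [← hxd] at hx
  have hx0 : x ≠ 0 := fun h => by rw [h, abs_zero] at hx; linarith
  have hB : 0 ≤ B := (norm_nonneg _).trans (hf 0)
  have hx1 : |x| ≤ 1 := by rw [abs_le]; constructor <;> linarith [hl.1, hl.2]
  have hκ1 : |κ| ≤ 4 / 3 := by
    have : κ = x * (1 + x ^ 2 / 3) := by rw [hκ]; ring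
    rw [this, abs_mul, abs_of_pos (by positivity : 0 < 1 + x ^ 2 / 3)]
    have h2 : x ^ 2 ≤ 1 := (sq_le_one_iff_abs_le_one x).mpr hx1
    calc |x| * (1 + x ^ 2 / 3) ≤ 1 * (4 / 3) := by
          refine mul_le_mul hx1 (by linarith) (by positivity) zero_le_one
      _ = _ := one_mul _
  -- The weight lies between `exp (-8/3)` and `exp (8/3)`. Passing to the weighted norm and back
  -- costs `exp (8/3)` each time, hence `exp (16/3)`.
  have hu : ∀ t, |-κ * cumNorm g t| ≤ 8 / 3 := fun t => by
    rw [abs_mul, abs_neg, abs_of_nonneg (cumNorm_nonneg g t)]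
    calc _ ≤ 4 / 3 * (2 : ℝ) := by
          gcongr
          · exact cumNorm_nonneg g t
          · exact hg2 ▸ cumNorm_le hg t
      _ = _ := by norm_num
  have hq : (1 + x ^ 2 / 3)⁻¹ ≤ (1 + η ^ 2 / 3)⁻¹ := by
    have : η ^ 2 ≤ x ^ 2 := by rw [← sq_abs x]; gcongr
    gcongr
  have key : ∀ n t, ‖(volterra volume g lam)^[n] f t‖ ≤
      (B * Real.exp (8 / 3) * (1 + η ^ 2 / 3)⁻¹ ^ n) * Real.exp (-κ * cumNorm g t) := by
    intro n
    induction n with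
    | zero =>
      intro t
      rw [pow_zero, mul_one, mul_assoc, ← Real.exp_add]
      refine (hf t).trans (le_mul_of_one_le_right hB (Real.one_le_exp ?_))
      linarith [(abs_le.mp (hu t)).1]
    | succ n ih =>
      intro t
      rw [Function.iterate_succ_apply', pow_succ, ← mul_assoc]
      refine (norm_volterra_le_weight hg hg2 hl hxd hx0 hκ ih (by positivity) t).trans ?_
      gcongr
  refine (key n s).trans ?_
  have h1 : Real.exp (-κ * cumNorm g s) ≤ Real.exp (8 / 3) :=
    Real.exp_le_exp.mpr ((le_abs_self _).trans (hu s))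
  calc _ ≤ (B * Real.exp (8 / 3) * (1 + η ^ 2 / 3)⁻¹ ^ n) * Real.exp (8 / 3) := by gcongr
    _ = (Real.exp (8 / 3) * Real.exp (8 / 3)) * (1 + η ^ 2 / 3)⁻¹ ^ n * B := by ring
    _ = _ := by rw [← Real.exp_add]; norm_num

end Far

/-! ### Cancellation in the squared operator near `λ = 1/2`. -/

theorem measurable_kern_left (lam s : ℝ) : Measurable fun r : ℝ => kern lam s r :=
  (measurable_kern (measurableSet_lt measurable_fst measurable_snd) lam).comp measurable_prodMk_left

theorem measurable_kern_right (lam t : ℝ) : Measurable fun r : ℝ => kern lam r t :=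
  (measurable_kern (measurableSet_lt measurable_fst measurable_snd) lam).comp
    (measurable_id.prodMk measurable_const)

theorem half_mem : (1 / 2 : ℝ) ∈ Set.Icc (0 : ℝ) 1 := by constructor <;> norm_num

theorem abs_kern_half (s t : ℝ) : |kern (1 / 2) s t| = 1 / 2 := by
  unfold kern
  split_ifs <;> norm_num [abs_of_pos, abs_of_neg]

section Near

variable {A : Type*} [NormedRing A] {g : ℝ → A}

/-- `t₀` is a Lebesgue point of `g` where `g` does not vanish, in quantitative form. -/
def IsGoodPoint (g : ℝ → A) (t₀ : ℝ) : Prop :=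
  g t₀ ≠ 0 ∧ ∃ δ₀ > 0, ∀ δ, 0 < δ → δ < δ₀ →
    ∫ t in Set.Icc (t₀ - δ) (t₀ + δ), ‖g t - g t₀‖ ≤ 2 * δ * (‖g t₀‖ / 4)

theorem ae_isGoodPoint (hg : Integrable g) : ∀ᵐ t, g t ≠ 0 → IsGoodPoint g t := by
  filter_upwards [IsUnifLocDoublingMeasure.ae_tendsto_average_norm_sub (μ := (volume : Measure ℝ))
    hg.locallyIntegrable 1] with t ht h0
  refine ⟨h0, ?_⟩
  have h1 := ht (l := nhdsWithin (0 : ℝ) (Set.Ioi 0)) (fun _ => t) (fun δ => δ) Filter.tendsto_id (by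
    filter_upwards [self_mem_nhdsWithin] with δ hδ
    exact Metric.mem_closedBall_self (by simpa using le_of_lt hδ))
  have h2 : ∀ᶠ δ in nhdsWithin (0 : ℝ) (Set.Ioi 0),
      ⨍ y in Metric.closedBall t δ, ‖g y - g t‖ < ‖g t‖ / 4 :=
    h1.eventually (gt_mem_nhds (by positivity))
  obtain ⟨δ₀, hδ₀, h3⟩ := mem_nhdsGT_iff_exists_Ioo_subset.mp h2
  refine ⟨δ₀, hδ₀, fun δ hδ hδ1 => ?_⟩
  have h4 : ⨍ y in Metric.closedBall t δ, ‖g y - g t‖ < ‖g t‖ / 4 := h3 ⟨hδ, hδ1⟩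
  rw [setAverage_eq, Real.closedBall_eq_Icc, Real.volume_real_Icc_of_le (by linarith),
    smul_eq_mul, inv_mul_lt_iff₀ (by linarith)] at h4
  linarith

theorem exists_two_goodPoints (hg : Integrable g) (h0 : 0 < ∫ t, ‖g t‖) :
    ∃ t₀ t₁, t₀ < t₁ ∧ IsGoodPoint g t₀ ∧ IsGoodPoint g t₁ := by
  by_contra hcon
  push Not at hcon
  have hsub : {t | IsGoodPoint g t}.Subsingleton := fun a ha b hb => by
    rcases lt_trichotomy a b with h | h | h
    · exact absurd hb (hcon a b h ha)
    · exact h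
    · exact absurd ha (hcon b a h hb)
  have h1 : ∀ᵐ t, ¬ IsGoodPoint g t := measure_eq_zero_iff_ae_notMem.mp (hsub.measure_zero volume)
  have h2 : ∫ t, ‖g t‖ = 0 := by
    refine integral_eq_zero_of_ae ?_
    filter_upwards [h1, ae_isGoodPoint hg] with t ha hb
    by_contra hne
    exact ha (hb (by simpa using hne))
  linarith

variable [NormedAlgebra ℝ A] [CompleteSpace A]

set_option linter.unusedSectionVars false

/-- The first two bounds compare `g` with the constant `g t₀`. In the third, the kernel is `1/2` to
the left of `t₀` and `-1/2` to the right, so the constant integrates to zero and only half the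
deviation from it remains. -/
theorem IsGoodPoint.integral_bounds (hg : Integrable g) {t₀ : ℝ} (h : IsGoodPoint g t₀) :
    ∃ δ₀ > 0, ∀ δ, 0 < δ → δ < δ₀ →
      2 * δ * (3 / 4 * ‖g t₀‖) ≤ ∫ t in Set.Icc (t₀ - δ) (t₀ + δ), ‖g t‖ ∧
      ∫ t in Set.Icc (t₀ - δ) (t₀ + δ), ‖g t‖ ≤ 2 * δ * (5 / 4 * ‖g t₀‖) ∧
      ‖∫ t in Set.Icc (t₀ - δ) (t₀ + δ), kern (1 / 2) t t₀ • g t‖ ≤ 2 * δ * (‖g t₀‖ / 8) := by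
  obtain ⟨h0, δ₀, hδ₀, hb⟩ := h
  refine ⟨δ₀, hδ₀, fun δ hδ hδ1 => ?_⟩
  have hb := hb δ hδ hδ1
  set c := g t₀
  set J := Set.Icc (t₀ - δ) (t₀ + δ) with hJ
  have hvol : volume.real J = 2 * δ := by
    rw [hJ, Real.volume_real_Icc_of_le (by linarith)]
    ring
  have hconst : IntegrableOn (fun _ => c) J :=
    integrableOn_const (by rw [hJ, Real.volume_Icc]; exact ENNReal.ofReal_ne_top)
  have hd : IntegrableOn (fun t => g t - c) J := hg.integrableOn.sub hconst
  have hcn : ∫ _t in J, ‖c‖ = 2 * δ * ‖c‖ := by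
    rw [setIntegral_const, hvol, smul_eq_mul]
  have hkint : ∫ t in J, kern (1 / 2) t t₀ = 0 := by
    have e : ∀ t, kern (1 / 2) t t₀ = (Set.Iio t₀).indicator (fun _ => (1 : ℝ)) t - 1 / 2 :=
      fun t => by
        unfold kern
        by_cases ht : t < t₀
        · rw [if_pos ht, Set.indicator_of_mem (Set.mem_Iio.mpr ht)]; norm_num
        · rw [if_neg ht, Set.indicator_of_notMem (by simpa using ht)]; norm_num
    have hJ' : J ∩ Set.Iio t₀ = Set.Ico (t₀ - δ) t₀ := by
      ext t
      simp only [hJ, Set.mem_inter_iff, Set.mem_Icc, Set.mem_Iio, Set.mem_Ico]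
      exact ⟨fun h => ⟨h.1.1, h.2⟩, fun h => ⟨⟨h.1, by linarith [h.2]⟩, h.2⟩⟩
    have hfin : volume J ≠ ⊤ := by rw [hJ, Real.volume_Icc]; exact ENNReal.ofReal_ne_top
    simp only [e]
    have hone : ∀ a : ℝ, Integrable (fun _ => a) (volume.restrict J) :=
      fun a => integrableOn_const hfin
    rw [integral_sub ((hone 1).indicator measurableSet_Iio) (hone _), setIntegral_indicator measurableSet_Iio, hJ', setIntegral_const,
      setIntegral_const, hvol, Real.volume_real_Ico_of_le (by linarith)]
    simp only [smul_eq_mul]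
    ring
  have hsmul : ∀ {f : ℝ → A}, IntegrableOn f J → IntegrableOn (fun t => kern (1 / 2) t t₀ • f t) J :=
    fun hf => hf.norm.mono' ((measurable_kern_right _ _).aestronglyMeasurable.smul hf.aestronglyMeasurable)
      (.of_forall fun t => by
        rw [norm_smul, Real.norm_eq_abs, abs_kern_half]
        linarith [norm_nonneg (‹ℝ → A› t)])
  refine ⟨?_, ?_, ?_⟩
  · have h1 : ∫ _t in J, ‖c‖ ≤ ∫ t in J, (‖g t‖ + ‖g t - c‖) :=
      integral_mono hconst.norm (hg.integrableOn.norm.add hd.norm) fun t => by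
        have := norm_sub_le (g t) (g t - c)
        rwa [sub_sub_cancel] at this
    rw [integral_add hg.integrableOn.norm hd.norm, hcn] at h1
    linarith
  · have h1 : ∫ t in J, ‖g t‖ ≤ ∫ t in J, (‖g t - c‖ + ‖c‖) :=
      integral_mono hg.integrableOn.norm (hd.norm.add hconst.norm) fun t => by
        have := norm_add_le (g t - c) c
        rwa [sub_add_cancel] at this
    rw [integral_add hd.norm hconst.norm, hcn] at h1
    linarith
  · have h1 : ∫ t in J, kern (1 / 2) t t₀ • g t = ∫ t in J, kern (1 / 2) t t₀ • (g t - c) := by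
      have h2 : ∫ t in J, kern (1 / 2) t t₀ • c = 0 := by
        rw [integral_smul_const, hkint, zero_smul]
      simp only [smul_sub]
      rw [integral_sub (hsmul hg.integrableOn) (hsmul hconst), h2, sub_zero]
    rw [h1]
    refine (norm_integral_le_of_norm_le (hd.norm.const_mul (1 / 2)) (.of_forall fun t => ?_)).trans ?_
    · rw [norm_smul, Real.norm_eq_abs, abs_kern_half]
    · rw [integral_const_mul]
      linarith

/-- The kernel of the square of `volterra volume g lam`, up to the last factor. -/
noncomputable def sqKernel (g : ℝ → A) (lam s t : ℝ) : A :=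
  ∫ r, (kern lam s r * kern lam r t) • g r

theorem integrable_sqKernel (hg : Integrable g) {lam : ℝ} (hl : lam ∈ Set.Icc (0 : ℝ) 1) (s t : ℝ) :
    Integrable fun r => (kern lam s r * kern lam r t) • g r := by
  refine hg.norm.mono' (((measurable_kern_left lam s).mul
    (measurable_kern_right lam t)).aestronglyMeasurable.smul hg.aestronglyMeasurable)
    (.of_forall fun r => ?_)
  rw [norm_smul, Real.norm_eq_abs, abs_mul]
  exact mul_le_of_le_one_left (norm_nonneg _)
    (mul_le_one₀ (abs_kern_le hl _ _) (abs_nonneg _) (abs_kern_le hl _ _))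

theorem norm_sqKernel_half_le (hg : Integrable g) (s t : ℝ) :
    ‖sqKernel g (1 / 2) s t‖ ≤ 1 / 4 * ∫ r, ‖g r‖ := by
  rw [← integral_const_mul]
  refine norm_integral_le_of_norm_le (hg.norm.const_mul _) (.of_forall fun r => ?_)
  rw [norm_smul, Real.norm_eq_abs, abs_mul, abs_kern_half, abs_kern_half]
  norm_num

/-- For `s` outside the window around `t₀` the factor `kern (1 / 2) s r` is constant on it, so the
sign change of the other factor produces the cancellation. Moving `t` slightly off `t₀` changes that
factor only on a much shorter interval. -/
theorem IsGoodPoint.sqKernel_gain (hg : Integrable g) {t₀ : ℝ} (h : IsGoodPoint g t₀) {r : ℝ}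
    (hr : 0 < r) : ∃ D > 0, ∃ ρ > 0, 0 < ∫ t in Set.Icc (t₀ - ρ) (t₀ + ρ), ‖g t‖ ∧
      ∀ s, r ≤ |s - t₀| → ∀ t ∈ Set.Icc (t₀ - ρ) (t₀ + ρ),
        ‖sqKernel g (1 / 2) s t‖ ≤ 1 / 4 * (∫ r, ‖g r‖) - D := by
  obtain ⟨δ₀, hδ₀, hb⟩ := h.integral_bounds hg
  have hc : 0 < ‖g t₀‖ := norm_pos_iff.mpr h.1
  set c := ‖g t₀‖
  obtain ⟨δ, hδ, hδ1⟩ : ∃ δ, 0 < δ ∧ δ < min δ₀ r := exists_between (lt_min hδ₀ hr)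
  obtain ⟨b1, -, b3⟩ := hb δ hδ (hδ1.trans_le (min_le_left _ _))
  have hρ : 0 < δ / 20 := by positivity
  obtain ⟨c1, c2, -⟩ := hb (δ / 20) hρ (by linarith [min_le_left δ₀ r])
  -- On the window the trivial bound is at least `3δc/8` and the actual one at most `δc/8`, a gain
  -- of `δc/4`. Moving `t` by at most `δ/20` loses at most `δc/16`, so more than `δc/8` is left.
  refine ⟨δ * c / 8, by positivity, δ / 20, hρ, lt_of_lt_of_le (by positivity) c1,
    fun s hs t ht => ?_⟩
  set J := Set.Icc (t₀ - δ) (t₀ + δ) with hJ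
  have hJm : MeasurableSet J := measurableSet_Icc
  have hsJ : ∀ r ∈ J, kern (1 / 2) s r = kern (1 / 2) s t₀ := fun u hu => by
    have h1 : δ < r := hδ1.trans_le (min_le_right _ _)
    have hu' : t₀ - δ ≤ u ∧ u ≤ t₀ + δ := hu
    unfold kern
    rcases le_abs.mp hs with h2 | h2
    · rw [if_neg (by linarith), if_neg (by linarith)]
    · rw [if_pos (by linarith), if_pos (by linarith)]
  have hi := integrable_sqKernel hg half_mem s t₀
  have h1 : ‖sqKernel g (1 / 2) s t₀‖ ≤ 1 / 4 * (∫ r, ‖g r‖) - δ * c / 4 := by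
    rw [sqKernel, ← integral_add_compl hJm hi, ← integral_add_compl hJm hg.norm]
    have h2 : ∫ r in J, (kern (1 / 2) s r * kern (1 / 2) r t₀) • g r =
        kern (1 / 2) s t₀ • ∫ r in J, kern (1 / 2) r t₀ • g r := by
      rw [← integral_smul]
      exact setIntegral_congr_fun hJm fun r hr => by simp only [hsJ r hr, mul_smul]
    have h3 : ‖∫ r in Jᶜ, (kern (1 / 2) s r * kern (1 / 2) r t₀) • g r‖ ≤
        1 / 4 * ∫ r in Jᶜ, ‖g r‖ := by
      rw [← integral_const_mul]
      refine norm_integral_le_of_norm_le (hg.norm.const_mul _).integrableOn (.of_forall fun r => ?_)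
      rw [norm_smul, Real.norm_eq_abs, abs_mul, abs_kern_half, abs_kern_half]
      norm_num
    refine (norm_add_le _ _).trans ?_
    rw [h2, norm_smul, Real.norm_eq_abs, abs_kern_half]
    linarith
  have h2 : ‖sqKernel g (1 / 2) s t - sqKernel g (1 / 2) s t₀‖ ≤ δ * c / 16 := by
    rw [sqKernel, sqKernel, ← integral_sub (integrable_sqKernel hg half_mem s t) hi]
    set N := Set.Icc (t₀ - δ / 20) (t₀ + δ / 20) with hN
    have h3 : ‖∫ r, ((kern (1 / 2) s r * kern (1 / 2) r t) • g r -
        (kern (1 / 2) s r * kern (1 / 2) r t₀) • g r)‖ ≤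
        ∫ r, N.indicator (fun r => 1 / 2 * ‖g r‖) r := by
      refine norm_integral_le_of_norm_le ((hg.norm.const_mul _).indicator measurableSet_Icc)
        (.of_forall fun u => ?_)
      rw [← sub_smul, ← mul_sub, norm_smul, norm_mul, Real.norm_eq_abs, abs_kern_half,
        Real.norm_eq_abs]
      by_cases hu : u ∈ N
      · rw [Set.indicator_of_mem hu]
        have : |kern (1 / 2) u t - kern (1 / 2) u t₀| ≤ 1 := by
          refine (abs_sub _ _).trans ?_
          rw [abs_kern_half, abs_kern_half]; norm_num
        have := mul_le_mul_of_nonneg_right this (norm_nonneg (g u))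
        linarith
      · rw [Set.indicator_of_notMem hu]
        have : kern (1 / 2) u t = kern (1 / 2) u t₀ := by
          have ht' : t₀ - δ / 20 ≤ t ∧ t ≤ t₀ + δ / 20 := ht
          have hu' : u < t₀ - δ / 20 ∨ t₀ + δ / 20 < u := by
            by_contra hcon
            push Not at hcon
            exact hu hcon
          unfold kern
          rcases hu' with h | h
          · rw [if_pos (by linarith), if_pos (by linarith)]
          · rw [if_neg (by linarith), if_neg (by linarith)]
        rw [this, sub_self, abs_zero, mul_zero, zero_mul]
    rw [integral_indicator measurableSet_Icc, integral_const_mul] at h3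
    linarith
  have h3 := norm_add_le (sqKernel g (1 / 2) s t₀)
    (sqKernel g (1 / 2) s t - sqKernel g (1 / 2) s t₀)
  rw [add_sub_cancel] at h3
  have : 0 < δ * c := by positivity
  linarith

end Near

/-! ### Uniform contraction at total norm two. -/

section Contraction

variable {A : Type*} [NormedRing A] [NormedAlgebra ℝ A] [CompleteSpace A] {g : ℝ → A}

theorem volterra_volterra (hg : Integrable g) {lam : ℝ} (hl : lam ∈ Set.Icc (0 : ℝ) 1)
    {f : ℝ → A} {B : ℝ} (hf : BddMeas volume f B) (s : ℝ) :
    volterra volume g lam (volterra volume g lam f) s =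
      ∫ t, sqKernel g lam s t * (g t * f t) := by
  have hm : MeasurableSet {p : ℝ × ℝ | p.1 < p.2} := measurableSet_lt measurable_fst measurable_snd
  have hgf := hf.integrable_mul hg
  have hi : Integrable (fun p : ℝ × ℝ => (kern lam s p.1 * kern lam p.1 p.2) •
      (g p.1 * (g p.2 * f p.2))) (volume.prod volume) := by
    refine (hg.mul_prod hgf).norm.mono' ((((measurable_kern_left lam s).comp measurable_fst).mul
      (measurable_kern hm lam)).aestronglyMeasurable.smul (hg.mul_prod hgf).aestronglyMeasurable)
      (.of_forall fun p => ?_)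
    rw [norm_smul, Real.norm_eq_abs, abs_mul]
    exact mul_le_of_le_one_left (norm_nonneg _)
      (mul_le_one₀ (abs_kern_le hl _ _) (abs_nonneg _) (abs_kern_le hl _ _))
  have h1 : volterra volume g lam (volterra volume g lam f) s =
      ∫ r, ∫ t, (kern lam s r * kern lam r t) • (g r * (g t * f t)) := by
    refine integral_congr_ae (.of_forall fun r => ?_)
    simp only [volterra]
    rw [← integral_const_mul_of_integrable (integrable_kern_smul hm hgf lam r), ← integral_smul]
    refine integral_congr_ae (.of_forall fun t => ?_)
    simp only [mul_smul_comm, mul_smul]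
  rw [h1, integral_integral_swap hi]
  refine integral_congr_ae (.of_forall fun t => ?_)
  simp only [sqKernel]
  rw [← integral_mul_const_of_integrable (integrable_sqKernel hg hl s t)]
  simp only [smul_mul_assoc]

theorem norm_sqKernel_sub_le (hg : Integrable g) {lam η : ℝ} (hl : lam ∈ Set.Icc (0 : ℝ) 1)
    (hη : |lam - 1 / 2| ≤ η) (s t : ℝ) :
    ‖sqKernel g lam s t‖ ≤ ‖sqKernel g (1 / 2) s t‖ + 2 * η * ∫ r, ‖g r‖ := by
  have h1 : ‖sqKernel g lam s t - sqKernel g (1 / 2) s t‖ ≤ 2 * η * ∫ r, ‖g r‖ := by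
    rw [sqKernel, sqKernel, ← integral_sub (integrable_sqKernel hg hl s t)
      (integrable_sqKernel hg half_mem s t), ← integral_const_mul]
    refine norm_integral_le_of_norm_le (hg.norm.const_mul _) (.of_forall fun r => ?_)
    rw [← sub_smul, norm_smul, Real.norm_eq_abs]
    gcongr
    have e : kern lam s r * kern lam r t - kern (1 / 2) s r * kern (1 / 2) r t =
        (lam - 1 / 2) * kern lam r t + kern (1 / 2) s r * (lam - 1 / 2) := by
      rw [kern_eq_add lam (1 / 2) s r, kern_eq_add lam (1 / 2) r t]
      ring
    rw [e]
    refine (abs_add_le _ _).trans ?_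
    rw [abs_mul, abs_mul, abs_kern_half]
    have := mul_le_mul hη (abs_kern_le hl r t) (abs_nonneg _) ((abs_nonneg _).trans hη)
    linarith [(abs_nonneg _).trans hη]
  have h2 := norm_add_le (sqKernel g (1 / 2) s t) (sqKernel g lam s t - sqKernel g (1 / 2) s t)
  rw [add_sub_cancel] at h2
  linarith

/-- Every `s` is at least half the gap away from one of two good points, and the kernel gain near
that point, times the mass of `‖g‖` there, lowers the trivial bound `1`. -/
theorem exists_sq_contraction (hg : Integrable g) (hg2 : ∫ t, ‖g t‖ = 2) :
    ∃ η > 0, ∃ q, 0 ≤ q ∧ q < 1 ∧ ∀ lam ∈ Set.Icc (0 : ℝ) 1, |lam - 1 / 2| ≤ η →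
      ∀ f B, BddMeas volume f B → ∀ s,
        ‖volterra volume g lam (volterra volume g lam f) s‖ ≤ q * B := by
  obtain ⟨t₀, t₁, h01, hp0, hp1⟩ := exists_two_goodPoints hg (by rw [hg2]; norm_num)
  have hr : 0 < (t₁ - t₀) / 2 := by linarith
  obtain ⟨D₀, hD₀, ρ₀, hρ₀, hm₀, hK₀⟩ := hp0.sqKernel_gain hg hr
  obtain ⟨D₁, hD₁, ρ₁, hρ₁, hm₁, hK₁⟩ := hp1.sqKernel_gain hg hr
  set m₀ := ∫ t in Set.Icc (t₀ - ρ₀) (t₀ + ρ₀), ‖g t‖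
  set m₁ := ∫ t in Set.Icc (t₁ - ρ₁) (t₁ + ρ₁), ‖g t‖
  obtain ⟨γ, hγ, hγ0, hγ1⟩ : ∃ γ > 0, γ ≤ D₀ * m₀ ∧ γ ≤ D₁ * m₁ :=
    ⟨min (D₀ * m₀) (D₁ * m₁), lt_min (by positivity) (by positivity), min_le_left _ _,
      min_le_right _ _⟩
  -- With `η = γ / 16` the kernel grows by at most `2 * η * 2 = γ / 4`, and integration against
  -- `‖g‖` of mass `2` turns this into `γ / 2`. The gain is at least `γ`, leaving `1 - γ / 2`; the
  -- maximum with `0` keeps `q` nonnegative.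
  refine ⟨γ / 16, by positivity, max (1 - γ / 2) 0, le_max_right _ _,
    max_lt (by linarith) one_pos, fun lam hl hη f B hf s => ?_⟩
  have hB : 0 ≤ B := (norm_nonneg _).trans (hf.bound 0)
  have key : ∀ (N : Set ℝ) (D : ℝ), MeasurableSet N → γ ≤ D * ∫ t in N, ‖g t‖ →
      (∀ t ∈ N, ‖sqKernel g (1 / 2) s t‖ ≤ 1 / 4 * (∫ r, ‖g r‖) - D) →
      ‖volterra volume g lam (volterra volume g lam f) s‖ ≤ (1 - γ / 2) * B := by
    intro N D hN hγD hD
    rw [volterra_volterra hg hl hf]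
    have h1 : ‖∫ t, sqKernel g lam s t * (g t * f t)‖ ≤
        ∫ t, ((1 / 2 + γ / 4) * B * ‖g t‖ - D * B * N.indicator (fun t => ‖g t‖) t) := by
      refine norm_integral_le_of_norm_le ((hg.norm.const_mul _).sub
        ((hg.norm.indicator hN).const_mul _)) (.of_forall fun t => ?_)
      have h2 := norm_sqKernel_sub_le hg hl hη s t
      rw [hg2] at h2
      have h3 : ‖sqKernel g lam s t * (g t * f t)‖ ≤ ‖sqKernel g lam s t‖ * (‖g t‖ * B) :=
        (norm_mul_le _ _).trans (mul_le_mul_of_nonneg_left ((norm_mul_le _ _).trans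
          (mul_le_mul_of_nonneg_left (hf.bound t) (norm_nonneg _))) (norm_nonneg _))
      refine h3.trans ?_
      have hgB : 0 ≤ ‖g t‖ * B := mul_nonneg (norm_nonneg _) hB
      by_cases ht : t ∈ N
      · have h4 := hD t ht
        rw [hg2] at h4
        rw [Set.indicator_of_mem ht]
        have := mul_le_mul_of_nonneg_right
          (show ‖sqKernel g lam s t‖ ≤ 1 / 2 + γ / 4 - D by linarith) hgB
        linarith
      · have h4 := norm_sqKernel_half_le hg s t
        rw [hg2] at h4
        rw [Set.indicator_of_notMem ht]
        have := mul_le_mul_of_nonneg_right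
          (show ‖sqKernel g lam s t‖ ≤ 1 / 2 + γ / 4 by linarith) hgB
        linarith
    refine h1.trans ?_
    rw [integral_sub (hg.norm.const_mul _) ((hg.norm.indicator hN).const_mul _),
      integral_const_mul, integral_const_mul, integral_indicator hN, hg2]
    have := mul_le_mul_of_nonneg_right hγD hB
    linarith
  refine le_trans ?_ (mul_le_mul_of_nonneg_right (le_max_left _ _) hB)
  rcases le_or_gt ((t₁ - t₀) / 2) |s - t₀| with hs | hs
  · exact key _ D₀ measurableSet_Icc hγ0 (hK₀ s hs)
  · refine key _ D₁ measurableSet_Icc hγ1 (hK₁ s ?_)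
    rw [abs_lt] at hs
    rw [le_abs]
    right
    linarith [hs.2]

/-- Contraction in the critical case. -/
theorem exists_contracting (hg : Integrable g) (hg2 : ∫ t, ‖g t‖ = 2) :
    ∃ b, Contracting volume g b := by
  obtain ⟨η, hη, q, hq0, hq1, hq⟩ := exists_sq_contraction hg hg2
  have hm : MeasurableSet {p : ℝ × ℝ | p.1 < p.2} := measurableSet_lt measurable_fst measurable_snd
  have hpos : (1 : ℝ) < 1 + (2 * η) ^ 2 / 3 := by linarith [show 0 < (2 * η) ^ 2 / 3 by positivity]
  -- The sum covers both regimes. The factor `2 = ∫ ‖g‖` pays for the one unpaired application when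
  -- `n` is odd, and `|lam - 1/2| > η` means `|2 * lam - 1| > 2 * η`.
  refine ⟨fun n => 2 * q ^ (n / 2) + Real.exp (16 / 3) * (1 + (2 * η) ^ 2 / 3)⁻¹ ^ n, ?_, ?_⟩
  · refine Summable.add (Summable.mul_left _ ?_) (Summable.mul_left _
      (summable_geometric_of_lt_one (by positivity) (inv_lt_one_of_one_lt₀ hpos)))
    have hs := (summable_geometric_of_lt_one hq0 hq1).hasSum
    refine (HasSum.even_add_odd (f := fun n => q ^ (n / 2)) (m := ∑' n, q ^ n)
      (m' := ∑' n, q ^ n) ?_ ?_).summable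
    · simpa using hs
    · convert hs using 3
      omega
  · intro lam hl f B hf n s
    have hB : 0 ≤ B := (norm_nonneg _).trans (hf.bound 0)
    rcases le_or_gt |lam - 1 / 2| η with hle | hgt
    · have heven : ∀ m f B, BddMeas volume f B →
          BddMeas volume ((volterra volume g lam)^[2 * m] f) (q ^ m * B) := by
        intro m
        induction m with
        | zero => intro f B hf; simpa using hf
        | succ m ih =>
          intro f B hf
          have h1 := ih f B hf
          refine ⟨(hf.iterate hm hg hl _).aesm, fun s => ?_⟩
          have h2 := hq lam hl hle _ _ h1 s
          rw [show 2 * (m + 1) = 2 * m + 1 + 1 by ring, Function.iterate_succ_apply',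
            Function.iterate_succ_apply', pow_succ', mul_assoc]
          exact h2
      have h1 : ‖(volterra volume g lam)^[n] f s‖ ≤ 2 * q ^ (n / 2) * B := by
        rcases Nat.even_or_odd' n with ⟨m, rfl | rfl⟩
        · have h2 := (heven m f B hf).bound s
          rw [Nat.mul_div_cancel_left m two_pos]
          have : 0 ≤ q ^ m * B := by positivity
          linarith
        · have h3 := hf.volterra hm hg hl
          rw [hg2] at h3
          have h2 := (heven m _ _ h3).bound s
          rw [Function.iterate_succ_apply, show (2 * m + 1) / 2 = m by omega]
          linarith
      refine h1.trans (mul_le_mul_of_nonneg_right (le_add_of_nonneg_right ?_) hB)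
      positivity
    · have h1 := norm_volterra_iterate_far hg hg2 hl (η := 2 * η) (by positivity) (by
        rw [show 2 * lam - 1 = 2 * (lam - 1 / 2) by ring, abs_mul, abs_two]
        linarith) hf.bound n s
      refine h1.trans (mul_le_mul_of_nonneg_right (le_add_of_nonneg_left ?_) hB)
      positivity

end Contraction

end Magnus

/-! ### The convergence theorem at total norm two. -/

theorem mainTheorem6 {A : Type*} [NormedRing A] [NormedAlgebra ℝ A] [CompleteSpace A]
    (I : Set ℝ) (hI : I.OrdConnected) (h : ℝ → A) (hint : IntegrableOn h I volume)
    (hnorm : ∫ t in I, ‖h t‖ = 2) :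
    -- all the integrals involved exist
    (∀ k : ℕ, IntegrableOn (fun t : Fin k → ℝ => Magnus.orderedProd h t) (Magnus.cube I k)) ∧
    (∀ k : ℕ, IntegrableOn (fun t : Fin k → ℝ => Magnus.magnusCommutator fun i => h (t i))
      (Magnus.simplex I k)) ∧
    -- the sum of the norms of the terms of the resolvent series is bounded on `[0, 1]`
    (∃ C : ℝ, ∀ lam ∈ Set.Icc (0 : ℝ) 1,
      Summable (fun n : ℕ => ‖Magnus.resolventTerm I h lam (n + 1)‖) ∧
      ∑' n : ℕ, ‖Magnus.resolventTerm I h lam (n + 1)‖ ≤ C) ∧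
    -- the Magnus series converges absolutely
    Summable (fun n : ℕ => ‖Magnus.magnusTerm I h (n + 1)‖) ∧
    -- the logarithmic Magnus formula, and the Magnus formula
    Magnus.LogAble (Magnus.rexp I h) ∧
    Magnus.magnusSeries I h = Magnus.log (Magnus.rexp I h) ∧
    Magnus.rexp I h = NormedSpace.exp (Magnus.magnusSeries I h) := by
  open Magnus in
  have hIm : MeasurableSet I := hI.measurableSet
  have hg : Integrable (I.indicator h) := (integrable_indicator_iff hIm).mpr hint
  have hg2 : ∫ t, ‖I.indicator h t‖ = 2 := by
    rw [← hnorm, ← integral_indicator hIm]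
    simp only [norm_indicator_eq_indicator_norm]
  have hm : MeasurableSet {p : ℝ × ℝ | p.1 < p.2} := measurableSet_lt measurable_fst measurable_snd
  obtain ⟨b, hc⟩ := exists_contracting hg hg2
  have hbound : ∀ lam ∈ Set.Icc (0 : ℝ) 1, ∀ n, ‖resolventTerm I h lam (n + 1)‖ ≤
      2 * (b n * ‖(1 : A)‖) := fun lam hl n => by
    rw [← resTerm_indicator hIm hint hl, ← hg2]
    exact hc.norm_resTerm_le hg hl n
  have hsum : Summable fun n => 2 * (b n * ‖(1 : A)‖) := (hc.summable.mul_right _).mul_left _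
  have hrexp : rexp I h = 1 + resSum volume (I.indicator h) 1 := by
    have h1 : (1 : ℝ) ∈ Set.Icc (0 : ℝ) 1 := by simp
    rw [rexp, ← (hc.hasSum_integral hm hg h1).tsum_eq]
    congr 2
    funext n
    rw [rexpTerm_eq hIm, resTerm_indicator hIm hint h1]
  have hlogAble : LogAble (rexp I h) := hrexp ▸ hc.logAble hm hg
  have hlog : magnusSeries I h = log (rexp I h) := by
    -- Continuity in `lam` holds because each resolvent term is a finite sum over permutations with
    -- coefficients polynomial in `lam`.
    have h1 := hc.hasSum_log hm hg fun n => by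
      refine ContinuousOn.congr (f := fun lam => resolventTerm I h lam (n + 1)) ?_
        fun lam hl => resTerm_indicator hIm hint hl n
      simp only [resolventTerm_eq_sum hIm hint]
      exact (continuous_finsetSum _ fun σ _ =>
        (continuous_chainWt _).smul continuous_const).continuousOn
    rw [← hrexp] at h1
    rw [magnusSeries, ← h1.tsum_eq]
    congr 1
    funext n
    rw [magnusTerm_eq hIm hint]
    refine intervalIntegral.integral_congr fun lam hl => ?_
    rw [Set.uIcc_of_le zero_le_one] at hl
    exact (resTerm_indicator hIm hint hl n).symm
  refine ⟨integrableOn_orderedProd hIm hint, integrableOn_magnusCommutator hIm hint,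
    ⟨∑' n, 2 * (b n * ‖(1 : A)‖), fun lam hl => ?_⟩, ?_, hlogAble, hlog, ?_⟩
  · have hs : Summable fun n => ‖resolventTerm I h lam (n + 1)‖ :=
      .of_nonneg_of_le (fun _ => norm_nonneg _) (hbound lam hl) hsum
    exact ⟨hs, hs.tsum_le_tsum (hbound lam hl) hsum⟩
  · refine .of_nonneg_of_le (fun _ => norm_nonneg _) (fun n => ?_) hsum
    rw [magnusTerm_eq hIm hint]
    have := intervalIntegral.norm_integral_le_of_norm_le_const (a := 0) (b := 1)
      (f := fun lam => resolventTerm I h lam (n + 1)) (C := 2 * (b n * ‖(1 : A)‖)) fun lam hl => by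
        rw [Set.uIoc_of_le zero_le_one] at hl
        exact hbound lam ⟨hl.1.le, hl.2⟩ n
    simpa using this
  · rw [hlog, hlogAble.exp_log]
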